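/- An incidence system is a pair $(P,L)$, where $P$ is a set (of points) and $L$ is a set of subsets of $P$ (lines). An isomorphism from $(P,L)$ to $(P',L')$ is a pair of bijections $f:P\to P'$, $g:L\to L'$ such that $x\in\ell$ implies $f(x)\in g(\ell)$. A subsystem of $(P,L)$ is an incidence system $(P',L')$ such that $P'\subseteq P$ and every $\ell'\in L'$ has the form $\ell'=\ell\cap P'$ with $\ell\in L$. The Pappus configuration $\mathbb P$ is the incidence system with nine points $x_i,y_i,z_i$ $(1\le i\le 3)$ and the nine lines $\{x_1,x_2,x_3\}$, $\{y_1,y_2,y_3\}$, $\{z_1,z_2,z_3\}$ and $\{x_i,y_j,z_k\}$ with $(i,j,k)$ a permutation of $(1,2,3)$. For a finite projective plane $\pi$, let $i(\mathbb P,\pi)$ be the number of subsystems of $\pi$ isomorphic to $\mathbb P$. A field plane is a projective plane isomorphic to $PG(2,\mathbb F)$ for some field $\mathbb F$, where the points and lines of $PG(2,\mathbb F)$ are the one- and two-dimensional subspaces of $\mathbb F^3$, with incidence given by inclusion. Theorem. Let $\pi$ be a finite projective plane of order $n$ (every line has exactly $n+1$ points and every point lies on exactly $n+1$ lines). Then $$i(\mathbb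 P,\pi)\;\le\;\frac23\binom{n^2+n+1}{2}\binom n3^{2},$$ and equality holds if and only if $\pi$ is a field plane. -/

import Mathlib

universe u

/-- An incidence system `(P, L)`: a set `P` of points (here inside an ambient type `α`), and a set
`L` of subsets of `P`, the lines.  A point and a line are incident when the point is an element
of the line. -/
@[ext]
structure IncidenceSystem (α : Type*) where
  points : Set α
  lines : Set (Set α)
  subset_points : ∀ l ∈ lines, l ⊆ points

namespace IncidenceSystem

/-- `Y` is a subsystem of `X`: its points are points of `X`, and each of its lines is the
intersection of a line of `X` with the point set of `Y`. -/
def IsSubsystem {α : Type*} (Y X : IncidenceSystem α) : Prop :=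
  Y.points ⊆ X.points ∧ ∀ l' ∈ Y.lines, ∃ l ∈ X.lines, l' = l ∩ Y.points

/-- A homomorphism of incidence systems: a map on points and a map on lines that preserve
incidence. -/
structure Hom {α β : Type*} (X : IncidenceSystem α) (Y : IncidenceSystem β) where
  onPoints : X.points → Y.points
  onLines : X.lines → Y.lines
  mem_of_mem : ∀ (x : X.points) (l : X.lines),
    (x : α) ∈ (l : Set α) → (onPoints x : β) ∈ (onLines l : Set β)

/-- `X` and `Y` are isomorphic: some homomorphism is one-to-one and onto both on points and on
lines. -/
def Isomorphic {α β : Type*} (X : IncidenceSystem α) (Y : IncidenceSystem β) : Prop :=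
  ∃ φ : Hom X Y, Function.Bijective φ.onPoints ∧ Function.Bijective φ.onLines

/-- The inclusion number `i(Y, X)`: the number of subsystems of `X` isomorphic to `Y`. -/
noncomputable def inclusionNumber {α β : Type*} (Y : IncidenceSystem β)
    (X : IncidenceSystem α) : ℕ :=
  {Z : IncidenceSystem α | IsSubsystem Z X ∧ Isomorphic Y Z}.ncard

/-- The incidence system of a configuration of points `P` and lines `L`: each line is identified
with the set of the points on it. -/
def ofConfiguration (P L : Type*) [Membership P L] : IncidenceSystem P where
  points := Set.univ
  lines := Set.range fun l : L => {p : P | p ∈ l}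
  subset_points := fun _ _ => Set.subset_univ _

open scoped LinearAlgebra.Projectivization in
/-- The projective plane `PG(2, F)` over a field `F`: the points are the one-dimensional subspaces
of `F³`, and each two-dimensional subspace gives a line, the set of the points contained in it. -/
def fieldPlane (F : Type*) [Field F] : IncidenceSystem (ℙ F (Fin 3 → F)) where
  points := Set.univ
  lines := {l | ∃ W : Submodule F (Fin 3 → F),
    Module.finrank F W = 2 ∧ l = {p | p.submodule ≤ W}}
  subset_points := fun _ _ => Set.subset_univ _

/-- `X` is a field plane: it is isomorphic to `PG(2, F)` for some field `F`. (The field embeds in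
the point set, so its universe is no restriction.) -/
def IsFieldPlane {α : Type u} (X : IncidenceSystem α) : Prop :=
  ∃ (F : Type u) (_ : Field F), Isomorphic (fieldPlane F) X

/-- The Pappus configuration, with its nine points `xᵢ = (0, i)`, `yᵢ = (1, i)`, `zᵢ = (2, i)`
and its nine lines. -/
def pappus : IncidenceSystem (Fin 3 × Fin 3) where
  points := Set.univ
  lines :=
    { {(0, 0), (0, 1), (0, 2)}, {(1, 0), (1, 1), (1, 2)}, {(2, 0), (2, 1), (2, 2)},
      {(0, 0), (1, 1), (2, 2)}, {(0, 1), (1, 2), (2, 0)}, {(0, 2), (1, 0), (2, 1)},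
      {(0, 0), (1, 2), (2, 1)}, {(0, 1), (1, 0), (2, 2)}, {(0, 2), (1, 1), (2, 0)} }
  subset_points := fun _ _ => Set.subset_univ _

end IncidenceSystem

/-! The bound is a double count of labelled figures. A hexagon is an ordered pair of distinct lines
with an ordered triple of points on each, all off the common point of the lines; it determines its
three cross joins. With N = n² + n + 1 there are N(N - 1)(n(n - 1)(n - 2))² hexagons
(`card_isHexagon`). A labelled Pappus configuration is exactly a hexagon whose cross joins are
collinear, since collinearity already excludes every unwanted incidence
(`IsHexagon.isPappusEmbedding`). The configuration has 108 automorphisms (`card_pappusAut`), so the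
labelled copies number 108 · i. Dividing the hexagon count by 108 gives the constant 2/3, and
equality means that every hexagon closes, that is, that the plane is Pappian.

It remains to see that a finite plane is Pappian exactly when it is a field plane. In a field plane,
suitably scaled vectors of the cross joins sum to zero (`HomogeneousCoordinates.pappian`).
Conversely, fix a line `e` and three points on it. The three pencils form a 3-net on the affine
points; the dual of Pappus's theorem is its Thomsen closure condition, so an abelian group `R`
coordinatizes it. Two further uses of Pappus show that translations preserve every parallel class,
so that non-vertical lines are graphs of additive maps plus constants, and that these slopes
commute. Evaluated at a fixed nonzero element, the slopes become the elements of a field, and the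
usual homogeneous coordinates follow. -/

open Configuration

/-- A projective plane is Pappian if, for any two distinct lines and any three distinct points on
each of them (off the other one), the three cross joins of the resulting hexagon are collinear. -/
def Pappian (P L : Type*) [Membership P L] : Prop :=
  ∀ (l m : L) (x y z : Fin 3 → P), Function.Injective x → Function.Injective y →
    (∀ i, x i ∈ l ∧ x i ∉ m) → (∀ i, y i ∈ m ∧ y i ∉ l) →
    (∀ i j k, i ≠ j → i ≠ k → j ≠ k → ∃ a : L, x i ∈ a ∧ y j ∈ a ∧ z k ∈ a) →
    ∃ h : L, ∀ k, z k ∈ h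

/-! ### Basic incidence and the dual of Pappus's theorem -/

section Plane

variable {P L : Type*} [Membership P L] [ProjectivePlane P L]

theorem line_eq_of_mem {p q : P} {l m : L} (hpq : p ≠ q) (hpl : p ∈ l) (hql : q ∈ l) (hpm : p ∈ m)
    (hqm : q ∈ m) : l = m :=
  (Nondegenerate.eq_or_eq hpl hql hpm hqm).resolve_left hpq

theorem point_eq_of_mem {p q : P} {l m : L} (hlm : l ≠ m) (hpl : p ∈ l) (hpm : p ∈ m) (hql : q ∈ l)
    (hqm : q ∈ m) : p = q :=
  (Nondegenerate.eq_or_eq hpl hql hpm hqm).resolve_right hlm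

theorem exists_line_mem_mem (p q : P) : ∃ l : L, p ∈ l ∧ q ∈ l := by
  by_cases h : p = q
  · subst h
    obtain ⟨p₁, p₂, p₃, l₁, l₂, l₃, h12, h13, h21, h22, -⟩ :=
      @ProjectivePlane.exists_config P L _ _
    by_cases hp : p = p₁
    · refine ⟨HasLines.mkLine (P := P) (L := L) (p₁ := p) (p₂ := p₂) ?_, ?_, ?_⟩
      · rintro rfl
        exact h12 (hp ▸ h22)
      all_goals exact (HasLines.mkLine_ax _).1
    · exact ⟨HasLines.mkLine hp, (HasLines.mkLine_ax hp).1, (HasLines.mkLine_ax hp).1⟩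
  · exact ⟨HasLines.mkLine h, HasLines.mkLine_ax h⟩

theorem exists_point_mem_mem {l m : L} (h : l ≠ m) : ∃ p : P, p ∈ l ∧ p ∈ m :=
  ⟨HasPoints.mkPoint h, HasPoints.mkPoint_ax h⟩

omit [ProjectivePlane P L] in
theorem Pappian.collinear (hP : Pappian P L) {l m a₁₂ a₂₁ a₁₃ a₃₁ a₂₃ a₃₂ : L}
    {x₁ x₂ x₃ y₁ y₂ y₃ z₁ z₂ z₃ : P}
    (hx₁₂ : x₁ ≠ x₂) (hx₁₃ : x₁ ≠ x₃) (hx₂₃ : x₂ ≠ x₃)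
    (hy₁₂ : y₁ ≠ y₂) (hy₁₃ : y₁ ≠ y₃) (hy₂₃ : y₂ ≠ y₃)
    (hx₁ : x₁ ∈ l ∧ x₁ ∉ m) (hx₂ : x₂ ∈ l ∧ x₂ ∉ m) (hx₃ : x₃ ∈ l ∧ x₃ ∉ m)
    (hy₁ : y₁ ∈ m ∧ y₁ ∉ l) (hy₂ : y₂ ∈ m ∧ y₂ ∉ l) (hy₃ : y₃ ∈ m ∧ y₃ ∉ l)
    (h₁₂ : x₁ ∈ a₁₂ ∧ y₂ ∈ a₁₂ ∧ z₃ ∈ a₁₂) (h₂₁ : x₂ ∈ a₂₁ ∧ y₁ ∈ a₂₁ ∧ z₃ ∈ a₂₁)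
    (h₁₃ : x₁ ∈ a₁₃ ∧ y₃ ∈ a₁₃ ∧ z₂ ∈ a₁₃) (h₃₁ : x₃ ∈ a₃₁ ∧ y₁ ∈ a₃₁ ∧ z₂ ∈ a₃₁)
    (h₂₃ : x₂ ∈ a₂₃ ∧ y₃ ∈ a₂₃ ∧ z₁ ∈ a₂₃) (h₃₂ : x₃ ∈ a₃₂ ∧ y₂ ∈ a₃₂ ∧ z₁ ∈ a₃₂) :
    ∃ h : L, z₁ ∈ h ∧ z₂ ∈ h ∧ z₃ ∈ h := by
  obtain ⟨h, hh⟩ := hP l m ![x₁, x₂, x₃] ![y₁, y₂, y₃] ![z₁, z₂, z₃]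
    (by
      intro i j hij
      fin_cases i <;> fin_cases j <;> simp_all)
    (by
      intro i j hij
      fin_cases i <;> fin_cases j <;> simp_all)
    (by
      intro i
      fin_cases i <;> simpa)
    (by
      intro i
      fin_cases i <;> simpa)
    (by
      intro i j k hij hik hjk
      fin_cases i <;> fin_cases j <;> fin_cases k <;> simp at hij hik hjk
      exacts [⟨_, h₁₂⟩, ⟨_, h₁₃⟩, ⟨_, h₂₁⟩, ⟨_, h₂₃⟩, ⟨_, h₃₁⟩, ⟨_, h₃₂⟩])
  exact ⟨h, hh 0, hh 1, hh 2⟩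

/-- The dual of Pappus's theorem, for the pencils of lines through `A` and `B`. -/
theorem Pappian.concurrent (hP : Pappian P L) {A B Q p₁₂ p₂₁ p₁₃ p₃₁ p₂₃ p₃₂ : P}
    {u₁ u₂ u₃ v₁ v₂ v₃ w₁ w₂ w₃ : L}
    (hu₁₂ : u₁ ≠ u₂) (hu₁₃ : u₁ ≠ u₃) (hu₂₃ : u₂ ≠ u₃)
    (hv₁₂ : v₁ ≠ v₂) (hv₁₃ : v₁ ≠ v₃) (hv₂₃ : v₂ ≠ v₃)
    (hu₁ : A ∈ u₁ ∧ B ∉ u₁) (hu₂ : A ∈ u₂ ∧ B ∉ u₂) (hu₃ : A ∈ u₃ ∧ B ∉ u₃)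
    (hv₁ : B ∈ v₁ ∧ A ∉ v₁) (hv₂ : B ∈ v₂ ∧ A ∉ v₂) (hv₃ : B ∈ v₃ ∧ A ∉ v₃)
    (h₁₂ : p₁₂ ∈ u₁ ∧ p₁₂ ∈ v₂ ∧ p₁₂ ∈ w₃) (h₂₁ : p₂₁ ∈ u₂ ∧ p₂₁ ∈ v₁ ∧ p₂₁ ∈ w₃)
    (h₁₃ : p₁₃ ∈ u₁ ∧ p₁₃ ∈ v₃ ∧ p₁₃ ∈ w₂) (h₃₁ : p₃₁ ∈ u₃ ∧ p₃₁ ∈ v₁ ∧ p₃₁ ∈ w₂)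
    (h₂₃ : p₂₃ ∈ u₂ ∧ p₂₃ ∈ v₃ ∧ p₂₃ ∈ w₁) (h₃₂ : p₃₂ ∈ u₃ ∧ p₃₂ ∈ v₂ ∧ p₃₂ ∈ w₁)
    (hQ₁ : Q ∈ w₁) (hQ₂ : Q ∈ w₂) : Q ∈ w₃ := by
  have notv : ∀ {p : P} {v v' : L}, v ≠ v' → B ∈ v → B ∈ v' → p ∈ v → ∀ {u : L}, B ∉ u → p ∈ u →
      p ∉ v' := by
    intro p v v' hvv hB hB' hp u hu hpu hp'
    exact hu (point_eq_of_mem hvv hp hp' hB hB' ▸ hpu)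
  have notu : ∀ {p : P} {v v' : L}, v ≠ v' → A ∈ v → A ∈ v' → p ∈ v → ∀ {u : L}, A ∉ u → p ∈ u →
      p ∉ v' := by
    intro p v v' hvv hB hB' hp u hu hpu hp'
    exact hu (point_eq_of_mem hvv hp hp' hB hB' ▸ hpu)
  -- Pappus on the lines `u₃` and `v₃`, with `A` and `B` themselves as vertices, has cross joins
  -- `Q`, `p₁₂`, `p₂₁`; the line of the last two is `w₃`.
  obtain ⟨h, h1, h2, h3⟩ := hP.collinear (l := u₃) (m := v₃) (x₁ := A) (x₂ := p₃₁) (x₃ := p₃₂)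
    (y₁ := B) (y₂ := p₂₃) (y₃ := p₁₃) (z₁ := Q) (z₂ := p₁₂) (z₃ := p₂₁)
    (a₁₂ := u₂) (a₂₁ := v₁) (a₁₃ := u₁) (a₃₁ := v₂) (a₂₃ := w₂) (a₃₂ := w₁)
    (by rintro rfl; exact hv₁.2 h₃₁.2.1) (by rintro rfl; exact hv₂.2 h₃₂.2.1)
    (by
      intro h
      exact notv hv₁₂ hv₁.1 hv₂.1 h₃₁.2.1 hu₃.2 h₃₁.1 (h ▸ h₃₂.2.1))
    (by rintro rfl; exact hu₂.2 h₂₃.1) (by rintro rfl; exact hu₁.2 h₁₃.1)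
    (by
      intro h
      exact notu hu₁₂.symm hu₂.1 hu₁.1 h₂₃.1 hv₃.2 h₂₃.2.1 (h ▸ h₁₃.1))
    ⟨hu₃.1, hv₃.2⟩ ⟨h₃₁.1, notv hv₁₃ hv₁.1 hv₃.1 h₃₁.2.1 hu₃.2 h₃₁.1⟩
    ⟨h₃₂.1, notv hv₂₃ hv₂.1 hv₃.1 h₃₂.2.1 hu₃.2 h₃₂.1⟩
    ⟨hv₃.1, hu₃.2⟩ ⟨h₂₃.2.1, notu hu₂₃ hu₂.1 hu₃.1 h₂₃.1 hv₃.2 h₂₃.2.1⟩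
    ⟨h₁₃.2.1, notu hu₁₃ hu₁.1 hu₃.1 h₁₃.1 hv₃.2 h₁₃.2.1⟩
    ⟨hu₂.1, h₂₃.1, h₂₁.1⟩ ⟨h₃₁.2.1, hv₁.1, h₂₁.2.1⟩ ⟨hu₁.1, h₁₃.1, h₁₂.1⟩
    ⟨h₃₂.2.1, hv₂.1, h₁₂.2.1⟩ ⟨h₃₁.2.2, h₁₃.2.2, hQ₂⟩ ⟨h₃₂.2.2, h₂₃.2.2, hQ₁⟩
  have hne : p₁₂ ≠ p₂₁ := by
    intro h
    exact notv hv₁₂.symm hv₂.1 hv₁.1 h₁₂.2.1 hu₁.2 h₁₂.1 (h ▸ h₂₁.2.1)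
  rwa [line_eq_of_mem hne h₁₂.2.2 h₂₁.2.2 h2 h3]

end Plane

/-! ### From 3-nets to abelian groups -/

/-- A 3-net satisfying the Thomsen condition is coordinatized by an abelian group. -/
theorem exists_addCommGroup_of_thomsen {A B C R : Type*} [Nonempty A] [Nonempty B]
    (T : A → B → C → Prop) (hC : ∀ a b, ∃! c, T a b c) (hB : ∀ a c, ∃! b, T a b c)
    (hA : ∀ b c, ∃! a, T a b c)
    (hT : ∀ {a₁ a₂ a₃ b₁ b₂ b₃ c d k}, T a₁ b₂ c → T a₂ b₁ c → T a₁ b₃ d → T a₃ b₁ d →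
      T a₂ b₃ k → T a₃ b₂ k) (e : R ≃ C) :
    ∃ (_ : AddCommGroup R) (α : R ≃ A) (β : R ≃ B) (γ : R ≃ C),
      ∀ x y z, T (α x) (β y) (γ z) ↔ x + y = z := by
  obtain ⟨a₀⟩ := ‹Nonempty A›
  obtain ⟨b₀⟩ := ‹Nonempty B›
  choose f hf hf' using hC
  choose g hg hg' using hB
  choose k hk hk' using hA
  simp only at hf' hg' hk'
  -- Both families are labelled through the third one, along `b₀` and along `a₀`, which makes the
  -- element labelling `a₀` and `b₀` a two-sided identity.
  let α : R ≃ A :=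
    { toFun r := k b₀ (e r)
      invFun a := e.symm (f a b₀)
      left_inv r := by simp [← hf' _ _ _ (hk b₀ (e r))]
      right_inv a := by simp [← hk' _ _ _ (hf a b₀)] }
  let β : R ≃ B :=
    { toFun r := g a₀ (e r)
      invFun b := e.symm (f a₀ b)
      left_inv r := by simp [← hf' _ _ _ (hg a₀ (e r))]
      right_inv b := by simp [← hg' _ _ _ (hf a₀ b)] }
  have hα : ∀ r, T (α r) b₀ (e r) := fun r => hk _ _
  have hβ : ∀ r, T a₀ (β r) (e r) := fun r => hg _ _
  let add : R → R → R := fun x y => e.symm (f (α x) (β y))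
  let zero : R := e.symm (f a₀ b₀)
  have hT' : ∀ x y, T (α x) (β y) (e (add x y)) := fun x y => by
    simpa [add] using hf (α x) (β y)
  have huniq : ∀ {x y z}, T (α x) (β y) (e z) → add x y = z := fun {x y z} h => by
    simp [add, ← hf' _ _ _ h]
  have α0 : α zero = a₀ := by
    simp only [α, zero, Equiv.coe_fn_mk, Equiv.apply_symm_apply]
    exact (hk' _ _ _ (hf a₀ b₀)).symm
  have β0 : β zero = b₀ := by
    simp only [β, zero, Equiv.coe_fn_mk, Equiv.apply_symm_apply]
    exact (hg' _ _ _ (hf a₀ b₀)).symm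
  have zero_add : ∀ x, add zero x = x := fun x => huniq (by rw [α0]; exact hβ x)
  have add_zero : ∀ x, add x zero = x := fun x => huniq (by rw [β0]; exact hα x)
  have thomsen : ∀ {x₁ x₂ x₃ y₁ y₂ y₃}, add x₁ y₂ = add x₂ y₁ → add x₁ y₃ = add x₃ y₁ →
      add x₃ y₂ = add x₂ y₃ := by
    intro x₁ x₂ x₃ y₁ y₂ y₃ h h'
    refine huniq (hT (b₁ := β y₁) (hT' x₁ y₂) ?_ (hT' x₁ y₃) ?_ (hT' x₂ y₃))
    · rw [h]; exact hT' _ _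
    · rw [h']; exact hT' _ _
  -- Thomsen with `x₁ = y₁ = 0` gives commutativity; with only `y₁ = 0` it gives (y + x) + z = (y +
  -- z) + x, which is associativity up to commutativity.
  have comm : ∀ x y, add x y = add y x := fun x y =>
    thomsen (x₁ := zero) (y₁ := zero) (by rw [zero_add, add_zero]) (by rw [zero_add, add_zero])
  have assoc : ∀ x y z, add (add x y) z = add x (add y z) := fun x y z => by
    rw [comm x y, comm x (add y z)]
    exact thomsen (x₁ := y) (y₁ := zero) (add_zero _).symm (add_zero _).symm
  let neg : R → R := fun x => α.symm (k (β x) (e zero))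
  have neg_add : ∀ x, add (neg x) x = zero := fun x =>
    huniq (by simpa [neg] using hk (β x) (e zero))
  let _ : Add R := ⟨add⟩
  let _ : Zero R := ⟨zero⟩
  let _ : Neg R := ⟨neg⟩
  let _ : AddGroup R := AddGroup.ofLeftAxioms assoc zero_add neg_add
  refine ⟨{ add_comm := comm }, α, β, e, fun x y z => ⟨fun h => huniq h, ?_⟩⟩
  rintro rfl
  exact hT' x y

/-- Coordinates with values in an abelian group `R` on the complement of the line `e`: the lines
`v x` through `Y`, `h y` through `X` and `d z` through `I` meet in a point exactly when
`x + y = z`. -/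
structure NetCoordinates (P L R : Type*) [Membership P L] [AddCommGroup R] where
  e : L
  X : P
  Y : P
  I : P
  X_mem : X ∈ e
  Y_mem : Y ∈ e
  I_mem : I ∈ e
  X_ne_Y : X ≠ Y
  I_ne_X : I ≠ X
  I_ne_Y : I ≠ Y
  v : R → L
  h : R → L
  d : R → L
  v_spec : ∀ x, Y ∈ v x ∧ v x ≠ e
  h_spec : ∀ x, X ∈ h x ∧ h x ≠ e
  d_spec : ∀ x, I ∈ d x ∧ d x ≠ e
  v_injective : Function.Injective v
  h_injective : Function.Injective h
  v_surjective : ∀ l, Y ∈ l → l ≠ e → ∃ x, v x = l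
  h_surjective : ∀ l, X ∈ l → l ≠ e → ∃ x, h x = l
  mem_d_iff : ∀ {x y z p}, p ∈ v x → p ∈ h y → (p ∈ d z ↔ x + y = z)

section Plane

variable {P L : Type*} [Membership P L] [ProjectivePlane P L]

/-- Two lines of different pencils meet in a single point, which is off `e`, and one line joins that
point to `C`. This is the 3-net axiom, used for all three orderings of the pencils. -/
theorem existsUnique_net_line {e : L} {A B C : P} (hA : A ∈ e) (hB : B ∈ e) (hC : C ∈ e)
    (hAB : A ≠ B) {u v : L} (hu : A ∈ u ∧ u ≠ e) (hv : B ∈ v ∧ v ≠ e) :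
    ∃! w : {l : L // C ∈ l ∧ l ≠ e}, ∃ p : P, p ∈ u ∧ p ∈ v ∧ p ∈ w.1 := by
  have huv : u ≠ v := by
    rintro rfl
    exact hu.2 (line_eq_of_mem hAB hu.1 hv.1 hA hB)
  obtain ⟨p, hpu, hpv⟩ := exists_point_mem_mem (P := P) huv
  have hpe : p ∉ e := fun h => hAB <|
    (point_eq_of_mem hu.2 hpu h hu.1 hA).symm.trans (point_eq_of_mem hv.2 hpv h hv.1 hB)
  obtain ⟨w, hpw, hCw⟩ := exists_line_mem_mem (L := L) p C
  refine ⟨⟨w, hCw, by rintro rfl; exact hpe hpw⟩, ⟨p, hpu, hpv, hpw⟩, ?_⟩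
  rintro ⟨w', hw', _⟩ ⟨p', hp'u, hp'v, hp'w⟩
  obtain rfl := point_eq_of_mem huv hpu hpv hp'u hp'v
  exact Subtype.ext (line_eq_of_mem (by rintro rfl; exact hpe hC) hp'w hw' hpw hCw)

theorem exists_line_through_ne {e : L} {A : P} (hA : A ∈ e) : ∃ l : L, A ∈ l ∧ l ≠ e := by
  obtain ⟨q, hq⟩ := Nondegenerate.exists_point (P := P) e
  obtain ⟨l, hAl, hql⟩ := exists_line_mem_mem (L := L) A q
  exact ⟨l, hAl, by rintro rfl; exact hq hql⟩

/-- The net formed by the pencils at `Y`, `X`, `I` satisfies the Thomsen condition: two of the cross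
lines pass through `I`, and dual Pappus forces the third to do so. -/
theorem Pappian.exists_netCoordinates {R : Type*} (hP : Pappian P L) {e : L} {X Y I : P}
    (hX : X ∈ e) (hY : Y ∈ e) (hI : I ∈ e) (hXY : X ≠ Y) (hIX : I ≠ X) (hIY : I ≠ Y)
    (f : R ≃ {l : L // I ∈ l ∧ l ≠ e}) :
    ∃ _ : AddCommGroup R, ∃ N : NetCoordinates P L R, N.e = e := by
  obtain ⟨v₀, hv₀⟩ := exists_line_through_ne hY
  obtain ⟨h₀, hh₀⟩ := exists_line_through_ne hX
  have : Nonempty {l : L // Y ∈ l ∧ l ≠ e} := ⟨⟨v₀, hv₀⟩⟩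
  have : Nonempty {l : L // X ∈ l ∧ l ≠ e} := ⟨⟨h₀, hh₀⟩⟩
  have cross : ∀ {A B : P}, A ≠ B → A ∈ e → B ∈ e → ∀ u : {l : L // A ∈ l ∧ l ≠ e},
      A ∈ u.1 ∧ B ∉ u.1 := fun hAB hA hB u =>
    ⟨u.2.1, fun h => u.2.2 (line_eq_of_mem hAB u.2.1 h hA hB)⟩
  obtain ⟨inst, α, β, γ, hs⟩ := exists_addCommGroup_of_thomsen
    (A := {l : L // Y ∈ l ∧ l ≠ e}) (B := {l : L // X ∈ l ∧ l ≠ e})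
    (fun u v w => ∃ p : P, p ∈ u.1 ∧ p ∈ v.1 ∧ p ∈ w.1)
    (fun a b => existsUnique_net_line hY hX hI hXY.symm a.2 b.2)
    (fun a c => by
      simpa only [and_comm (a := _ ∈ c.1)] using existsUnique_net_line hY hI hX hIY.symm a.2 c.2)
    (fun b c => by
      simpa only [and_comm, and_left_comm, and_assoc] using existsUnique_net_line hX hI hY hIX.symm b.2 c.2)
    (by
      have uniqC : ∀ (a : {l : L // Y ∈ l ∧ l ≠ e}) (b : {l : L // X ∈ l ∧ l ≠ e})
          {c c' : {l : L // I ∈ l ∧ l ≠ e}}, (∃ p : P, p ∈ a.1 ∧ p ∈ b.1 ∧ p ∈ c.1) →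
          (∃ p : P, p ∈ a.1 ∧ p ∈ b.1 ∧ p ∈ c'.1) → c = c' := fun a b _ _ h h' =>
        (existsUnique_net_line hY hX hI hXY.symm a.2 b.2).unique h h'
      have uniqB : ∀ (a : {l : L // Y ∈ l ∧ l ≠ e}) (c : {l : L // I ∈ l ∧ l ≠ e})
          {b b' : {l : L // X ∈ l ∧ l ≠ e}}, (∃ p : P, p ∈ a.1 ∧ p ∈ b.1 ∧ p ∈ c.1) →
          (∃ p : P, p ∈ a.1 ∧ p ∈ b'.1 ∧ p ∈ c.1) → b = b' := fun a c _ _ h h' =>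
        (existsUnique_net_line hY hI hX hIY.symm a.2 c.2).unique
          (by simpa only [and_comm] using h) (by simpa only [and_comm] using h')
      have uniqA : ∀ (b : {l : L // X ∈ l ∧ l ≠ e}) (c : {l : L // I ∈ l ∧ l ≠ e})
          {a a' : {l : L // Y ∈ l ∧ l ≠ e}}, (∃ p : P, p ∈ a.1 ∧ p ∈ b.1 ∧ p ∈ c.1) →
          (∃ p : P, p ∈ a'.1 ∧ p ∈ b.1 ∧ p ∈ c.1) → a = a' := fun b c _ _ h h' =>
        (existsUnique_net_line hX hI hY hIX.symm b.2 c.2).unique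
          (h.imp fun _ h => ⟨h.2.1, h.2.2, h.1⟩)
          (h'.imp fun _ h => ⟨h.2.1, h.2.2, h.1⟩)
      intro a₁ a₂ a₃ b₁ b₂ b₃ c d k h₁₂ h₂₁ h₁₃ h₃₁ h₂₃
      -- If two lines of a pencil coincide, the net axioms alone either give the closure or
      -- contradict an earlier case; dual Pappus needs the lines distinct.
      by_cases ha₁₂ : a₁ = a₂
      · subst ha₁₂
        obtain rfl := uniqB _ _ h₁₂ h₂₁
        obtain rfl := uniqC _ _ h₁₃ h₂₃
        exact h₃₁
      by_cases ha₁₃ : a₁ = a₃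
      · subst ha₁₃
        obtain rfl := uniqB _ _ h₁₃ h₃₁
        obtain rfl := uniqC _ _ h₂₁ h₂₃
        exact h₁₂
      by_cases ha₂₃ : a₂ = a₃
      · subst ha₂₃
        obtain rfl := uniqC _ _ h₂₁ h₃₁
        obtain rfl := uniqB _ _ h₁₂ h₁₃
        exact h₂₃
      by_cases hb₁₂ : b₁ = b₂
      · subst hb₁₂
        exact absurd (uniqA _ _ h₁₂ h₂₁) ha₁₂
      by_cases hb₁₃ : b₁ = b₃
      · subst hb₁₃
        exact absurd (uniqA _ _ h₁₃ h₃₁) ha₁₃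
      by_cases hb₂₃ : b₂ = b₃
      · subst hb₂₃
        obtain rfl := uniqC _ _ h₁₂ h₁₃
        exact absurd (uniqA _ _ h₂₁ h₃₁) ha₂₃
      obtain ⟨p₁₂, h₁₂⟩ := h₁₂
      obtain ⟨p₂₁, h₂₁⟩ := h₂₁
      obtain ⟨p₁₃, h₁₃⟩ := h₁₃
      obtain ⟨p₃₁, h₃₁⟩ := h₃₁
      obtain ⟨p₂₃, h₂₃⟩ := h₂₃
      obtain ⟨k', ⟨p₃₂, h₃₂⟩, -⟩ := existsUnique_net_line hY hX hI hXY.symm a₃.2 b₂.2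
      have hyx := cross hXY.symm hY hX
      have hxy := cross hXY hX hY
      obtain ⟨w, hw, hw'⟩ := exists_line_mem_mem (L := L) p₂₃ p₃₂
      have hIw : I ∈ w := hP.concurrent (u₁ := a₃.1) (u₂ := a₂.1) (u₃ := a₁.1) (v₁ := b₃.1)
        (v₂ := b₂.1) (v₃ := b₁.1) (w₁ := c.1) (w₂ := d.1)
        (fun h => ha₂₃ (Subtype.ext h.symm)) (fun h => ha₁₃ (Subtype.ext h.symm))
        (fun h => ha₁₂ (Subtype.ext h.symm)) (fun h => hb₂₃ (Subtype.ext h.symm))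
        (fun h => hb₁₃ (Subtype.ext h.symm)) (fun h => hb₁₂ (Subtype.ext h.symm))
        (hyx _) (hyx _) (hyx _) (hxy _) (hxy _) (hxy _)
        ⟨h₃₂.1, h₃₂.2.1, hw'⟩ ⟨h₂₃.1, h₂₃.2.1, hw⟩ h₃₁ h₁₃ h₂₁ h₁₂ c.2.1 d.2.1
      have hne : p₂₃ ≠ I := by
        rintro rfl
        exact hIX (point_eq_of_mem b₃.2.2 h₂₃.2.1 hI b₃.2.1 hX)
      rw [line_eq_of_mem hne hw hIw h₂₃.2.2 k.2.1] at hw'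
      exact ⟨p₃₂, h₃₂.1, h₃₂.2.1, hw'⟩) f
  refine ⟨inst, ⟨e, X, Y, I, hX, hY, hI, hXY, hIX, hIY, fun x => (α x).1, fun x => (β x).1,
    fun x => (γ x).1, fun x => (α x).2, fun x => (β x).2, fun x => (γ x).2,
    Subtype.val_injective.comp α.injective, Subtype.val_injective.comp β.injective,
    fun l hl hl' => ⟨α.symm ⟨l, hl, hl'⟩, by simp⟩,
    fun l hl hl' => ⟨β.symm ⟨l, hl, hl'⟩, by simp⟩, ?_⟩, rfl⟩
  intro x y z p hpx hpy
  refine ⟨fun hp => (hs x y z).1 ⟨p, hpx, hpy, hp⟩, fun h => ?_⟩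
  obtain ⟨q, hqx, hqy, hqz⟩ := (hs x y z).2 h
  have hne : (α x).1 ≠ (β y).1 := fun h =>
    (α x).2.2 (line_eq_of_mem hXY (h ▸ (β y).2.1) (α x).2.1 hX hY)
  rwa [point_eq_of_mem hne hpx hpy hqx hqy]

/-! ### Affine points, parallel classes, translations and slopes -/

namespace NetCoordinates

variable {R : Type*} [AddCommGroup R] (N : NetCoordinates P L R)

/-- Interchanging the two coordinates. -/
def swap : NetCoordinates P L R where
  e := N.e
  X := N.Y
  Y := N.X
  I := N.I
  X_mem := N.Y_mem
  Y_mem := N.X_mem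
  I_mem := N.I_mem
  X_ne_Y := N.X_ne_Y.symm
  I_ne_X := N.I_ne_Y
  I_ne_Y := N.I_ne_X
  v := N.h
  h := N.v
  d := N.d
  v_spec := N.h_spec
  h_spec := N.v_spec
  d_spec := N.d_spec
  v_injective := N.h_injective
  h_injective := N.v_injective
  v_surjective := N.h_surjective
  h_surjective := N.v_surjective
  mem_d_iff h h' := by rw [add_comm]; exact N.mem_d_iff h' h

theorem v_ne_h (x y : R) : N.v x ≠ N.h y := fun h =>
  (N.v_spec x).2 (line_eq_of_mem N.X_ne_Y (h ▸ (N.h_spec y).1) (N.v_spec x).1 N.X_mem N.Y_mem)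

/-- The point with coordinates `(x, y)`. -/
noncomputable def pt (x y : R) : P := (exists_point_mem_mem (N.v_ne_h x y)).choose

theorem pt_mem_v (x y : R) : N.pt x y ∈ N.v x :=
  (exists_point_mem_mem (N.v_ne_h x y)).choose_spec.1

theorem pt_mem_h (x y : R) : N.pt x y ∈ N.h y :=
  (exists_point_mem_mem (N.v_ne_h x y)).choose_spec.2

variable {N}

theorem eq_pt {p : P} {x y : R} (hx : p ∈ N.v x) (hy : p ∈ N.h y) : p = N.pt x y :=
  point_eq_of_mem (N.v_ne_h x y) hx hy (N.pt_mem_v x y) (N.pt_mem_h x y)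

variable (N)

theorem swap_pt (x y : R) : N.swap.pt x y = N.pt y x :=
  N.eq_pt (N.swap.pt_mem_h x y) (N.swap.pt_mem_v x y)

theorem pt_notMem (x y : R) : N.pt x y ∉ N.e := fun h => N.X_ne_Y <|
  (point_eq_of_mem (N.h_spec y).2 (N.pt_mem_h x y) h (N.h_spec y).1 N.X_mem).symm.trans
    (point_eq_of_mem (N.v_spec x).2 (N.pt_mem_v x y) h (N.v_spec x).1 N.Y_mem)

variable {N}

theorem pt_ne {D : P} (hD : D ∈ N.e) (x y : R) : N.pt x y ≠ D := by
  rintro rfl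
  exact N.pt_notMem x y hD

theorem pt_mem_v_iff {x y x' : R} : N.pt x y ∈ N.v x' ↔ x = x' := by
  refine ⟨fun h => N.v_injective ?_, fun h => h ▸ N.pt_mem_v x y⟩
  exact line_eq_of_mem (N.pt_ne N.Y_mem x y) (N.pt_mem_v x y) (N.v_spec x).1 h (N.v_spec x').1

theorem pt_mem_h_iff {x y y' : R} : N.pt x y ∈ N.h y' ↔ y = y' := by
  refine ⟨fun h => N.h_injective ?_, fun h => h ▸ N.pt_mem_h x y⟩
  exact line_eq_of_mem (N.pt_ne N.X_mem x y) (N.pt_mem_h x y) (N.h_spec y).1 h (N.h_spec y').1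

theorem pt_mem_d_iff {x y z : R} : N.pt x y ∈ N.d z ↔ x + y = z :=
  N.mem_d_iff (N.pt_mem_v x y) (N.pt_mem_h x y)

theorem pt_inj {x y x' y' : R} : N.pt x y = N.pt x' y' ↔ x = x' ∧ y = y' := by
  refine ⟨fun h => ⟨pt_mem_v_iff.1 (h ▸ N.pt_mem_v x' y'), pt_mem_h_iff.1 (h ▸ N.pt_mem_h x' y')⟩, ?_⟩
  rintro ⟨rfl, rfl⟩
  rfl

theorem exists_pt {p : P} (hp : p ∉ N.e) : ∃ x y, p = N.pt x y := by
  obtain ⟨l, hpl, hYl⟩ := exists_line_mem_mem (L := L) p N.Y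
  obtain ⟨m, hpm, hXm⟩ := exists_line_mem_mem (L := L) p N.X
  obtain ⟨x, rfl⟩ := N.v_surjective l hYl (by rintro rfl; exact hp hpl)
  obtain ⟨y, rfl⟩ := N.h_surjective m hXm (by rintro rfl; exact hp hpm)
  exact ⟨x, y, eq_pt hpl hpm⟩

theorem pt_notMem_of_mem {l : L} {D D' : P} (hD : D ∈ N.e) (hD' : D' ∈ N.e) (h : D ≠ D') (hl : D ∈ l)
    (hl' : D' ∈ l) (x y : R) : N.pt x y ∉ l := fun hp =>
  N.pt_notMem x y (line_eq_of_mem h hl hl' hD hD' ▸ hp)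

theorem eq_v {l : L} {x y : R} (hY : N.Y ∈ l) (h : N.pt x y ∈ l) : l = N.v x :=
  line_eq_of_mem (N.pt_ne N.Y_mem x y) h hY (N.pt_mem_v x y) (N.v_spec x).1

theorem eq_h {l : L} {x y : R} (hX : N.X ∈ l) (h : N.pt x y ∈ l) : l = N.h y :=
  line_eq_of_mem (N.pt_ne N.X_mem x y) h hX (N.pt_mem_h x y) (N.h_spec y).1

theorem eq_d {l : L} {x y : R} (hI : N.I ∈ l) (h : N.pt x y ∈ l) : l = N.d (x + y) :=
  line_eq_of_mem (N.pt_ne N.I_mem x y) h hI (pt_mem_d_iff.2 rfl) (N.d_spec _).1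

variable (L) in
/-- The points `D`, `p` and `q` lie on a line. -/
def Along (D p q : P) : Prop := ∃ l : L, D ∈ l ∧ p ∈ l ∧ q ∈ l

end NetCoordinates

end Plane

namespace NetCoordinates

variable {P L : Type*} [Membership P L] [ProjectivePlane P L]
variable {R : Type*} [AddCommGroup R] {N : NetCoordinates P L R}

theorem along_Y_iff {x y x' y' : R} : Along L N.Y (N.pt x y) (N.pt x' y') ↔ x = x' := by
  constructor
  · rintro ⟨l, hl, h, h'⟩
    obtain rfl := eq_v hl h
    exact (pt_mem_v_iff.1 h').symm
  · rintro rfl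
    exact ⟨N.v x, (N.v_spec x).1, N.pt_mem_v _ _, N.pt_mem_v _ _⟩

theorem along_X_iff {x y x' y' : R} : Along L N.X (N.pt x y) (N.pt x' y') ↔ y = y' := by
  constructor
  · rintro ⟨l, hl, h, h'⟩
    obtain rfl := eq_h hl h
    exact (pt_mem_h_iff.1 h').symm
  · rintro rfl
    exact ⟨N.h y, (N.h_spec y).1, N.pt_mem_h _ _, N.pt_mem_h _ _⟩

theorem along_I_iff {x y x' y' : R} :
    Along L N.I (N.pt x y) (N.pt x' y') ↔ x + y = x' + y' := by
  constructor
  · rintro ⟨l, hl, h, h'⟩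
    obtain rfl := eq_d hl h
    exact (pt_mem_d_iff.1 h').symm
  · intro h
    exact ⟨N.d (x + y), (N.d_spec _).1, pt_mem_d_iff.2 rfl, pt_mem_d_iff.2 h.symm⟩

theorem Along.refl (D p : P) : Along L D p p := by
  obtain ⟨l, h, h'⟩ := exists_line_mem_mem (L := L) D p
  exact ⟨l, h, h', h'⟩

omit [ProjectivePlane P L] in
theorem Along.symm {D p q : P} (h : Along L D p q) : Along L D q p := by
  obtain ⟨l, h, hp, hq⟩ := h
  exact ⟨l, h, hq, hp⟩

theorem Along.trans {D p q : P} {x y : R} (hD : D ∈ N.e) (h : Along L D p (N.pt x y))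
    (h' : Along L D (N.pt x y) q) : Along L D p q := by
  obtain ⟨l, hl, hp, hq⟩ := h
  obtain ⟨l', hl', hp', hq'⟩ := h'
  obtain rfl := line_eq_of_mem (pt_ne hD x y) hq hl hp' hl'
  exact ⟨l, hl, hp, hq'⟩

/-- Two distinct affine points lie along a unique direction. -/
theorem Along.direction_unique {D D' : P} (hD : D ∈ N.e) (hD' : D' ∈ N.e) {x y : R} {q : P}
    (hne : N.pt x y ≠ q) (h : Along L D (N.pt x y) q) (h' : Along L D' (N.pt x y) q) :
    D = D' := by
  obtain ⟨l, hl, hp, hq⟩ := h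
  obtain ⟨l', hl', hp', hq'⟩ := h'
  obtain rfl := line_eq_of_mem hne hp hq hp' hq'
  by_contra hDD
  exact pt_notMem_of_mem hD hD' hDD hl hl' x y hp

theorem exists_along_of_v {D : P} (hD : D ∈ N.e) (hY : D ≠ N.Y) (p : P) (hp : p ∉ N.e) (x : R) :
    ∃ y, Along L D p (N.pt x y) := by
  obtain ⟨l, hl, hpl⟩ := exists_line_mem_mem (L := L) D p
  have hne : l ≠ N.v x := by
    rintro rfl
    exact (N.v_spec x).2 (line_eq_of_mem hY hl (N.v_spec x).1 hD N.Y_mem)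
  obtain ⟨q, hql, hqx⟩ := exists_point_mem_mem (P := P) hne
  have hq : q ∉ N.e := by
    intro hq
    obtain rfl := point_eq_of_mem (N.v_spec x).2 hqx hq (N.v_spec x).1 N.Y_mem
    exact hp (line_eq_of_mem hY hl hql hD hq ▸ hpl)
  obtain ⟨x', y, rfl⟩ := exists_pt hq
  obtain rfl := pt_mem_v_iff.1 hqx
  exact ⟨y, l, hl, hpl, hql⟩

theorem exists_along_of_h {D : P} (hD : D ∈ N.e) (hX : D ≠ N.X) (p : P) (hp : p ∉ N.e) (y : R) :
    ∃ x, Along L D p (N.pt x y) := by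
  obtain ⟨x, hx⟩ := exists_along_of_v (N := N.swap) hD hX p hp y
  rw [swap_pt] at hx
  exact ⟨x, hx⟩

/-- Dual Pappus and Pappus are each used to find a point of the line `v (x + a)` on the line joining
`Z` to `(x₂, y₀ + a)`. The first such point is `(x + a, k)` and the second lies on the parallel
through `(x₂ + a, y₀)`; they must coincide. -/
theorem along_translate_of_ne (hP : Pappian P L) {D : P} (hD : D ∈ N.e) (hX : D ≠ N.X)
    (hY : D ≠ N.Y) (hI : D ≠ N.I) {x x₂ k y₀ a : R} (ha : a ≠ 0) (hk : k ≠ y₀) (hxa : x + a ≠ x₂)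
    (h : Along L D (N.pt x k) (N.pt x₂ y₀)) : Along L D (N.pt (x + a) k) (N.pt (x₂ + a) y₀) := by
  obtain ⟨l₂, hDl₂, hxk, hx₂⟩ := h
  have hxx₂ : x ≠ x₂ := by
    rintro rfl
    have := line_eq_of_mem (by simpa [pt_inj] using hk) hxk hx₂ (N.pt_mem_v x k) (N.pt_mem_v x y₀)
    exact pt_notMem_of_mem hD N.Y_mem hY hDl₂ (this ▸ (N.v_spec x).1) x k hxk
  have hxa' : x ≠ x + a := by simpa using ha
  have hya : y₀ ≠ y₀ + a := by simpa using ha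
  have hl₂d : N.d (x + a + y₀) ≠ l₂ := fun h =>
    pt_notMem_of_mem hD N.I_mem hI hDl₂ (h ▸ (N.d_spec _).1) x k hxk
  obtain ⟨Z, hZd, hZl₂⟩ := exists_point_mem_mem (P := P) hl₂d
  have hYv : ∀ x, N.Y ∈ N.v x ∧ N.X ∉ N.v x := fun x => ⟨(N.v_spec x).1, fun h =>
    pt_notMem_of_mem N.X_mem N.Y_mem N.X_ne_Y h (N.v_spec x).1 x 0 (N.pt_mem_v _ _)⟩
  have hXh : ∀ y, N.X ∈ N.h y ∧ N.Y ∉ N.h y := fun y => ⟨(N.h_spec y).1, fun h =>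
    pt_notMem_of_mem N.X_mem N.Y_mem N.X_ne_Y (N.h_spec y).1 h 0 y (N.pt_mem_h _ _)⟩
  have hd₁ : N.pt x (y₀ + a) ∈ N.d (x + a + y₀) := pt_mem_d_iff.2 (by abel)
  have hd₂ : N.pt (x + a) y₀ ∈ N.d (x + a + y₀) := pt_mem_d_iff.2 rfl
  obtain ⟨g, hgZ, hg₂, hg₁⟩ : ∃ g : L, Z ∈ g ∧ N.pt x₂ (y₀ + a) ∈ g ∧ N.pt (x + a) k ∈ g := by
    by_cases hka : y₀ + a = k
    · subst hka
      obtain rfl := point_eq_of_mem hl₂d hZd hZl₂ hd₁ hxk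
      exact ⟨N.h (y₀ + a), N.pt_mem_h _ _, N.pt_mem_h _ _, N.pt_mem_h _ _⟩
    · obtain ⟨g, hg₂, hg₁⟩ := exists_line_mem_mem (L := L) (N.pt x₂ (y₀ + a)) (N.pt (x + a) k)
      refine ⟨g, ?_, hg₂, hg₁⟩
      exact hP.concurrent (u₁ := N.v x₂) (u₂ := N.v (x + a)) (u₃ := N.v x) (v₁ := N.h k)
        (v₂ := N.h (y₀ + a)) (v₃ := N.h y₀) (w₁ := N.d (x + a + y₀)) (w₂ := l₂)
        (N.v_injective.ne hxa.symm) (N.v_injective.ne hxx₂.symm) (N.v_injective.ne hxa'.symm)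
        (N.h_injective.ne (Ne.symm hka)) (N.h_injective.ne hk) (N.h_injective.ne hya.symm)
        (hYv _) (hYv _) (hYv _) (hXh _) (hXh _) (hXh _)
        ⟨N.pt_mem_v _ _, N.pt_mem_h _ _, hg₂⟩ ⟨N.pt_mem_v _ _, N.pt_mem_h _ _, hg₁⟩
        ⟨N.pt_mem_v _ _, N.pt_mem_h _ _, hx₂⟩ ⟨N.pt_mem_v _ _, N.pt_mem_h _ _, hxk⟩
        ⟨N.pt_mem_v _ _, N.pt_mem_h _ _, hd₂⟩ ⟨N.pt_mem_v _ _, N.pt_mem_h _ _, hd₁⟩ hZd hZl₂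
  have hgv : g ≠ N.v (x + a) := by
    rintro rfl
    exact hxa (pt_mem_v_iff.1 hg₂).symm
  have hZne : Z ≠ N.pt x₂ (y₀ + a) := by
    rintro rfl
    have := line_eq_of_mem (by simpa [pt_inj] using ha) hZl₂ hx₂ (N.pt_mem_v _ _) (N.pt_mem_v _ _)
    exact pt_notMem_of_mem hD N.Y_mem hY hDl₂ (this ▸ (N.v_spec x₂).1) x k hxk
  -- The point `(x + a, k')` is defined by the desired parallelism; Pappus on the lines `h y₀` and
  -- `e` then puts it on `g`, whence `k' = k`.
  obtain ⟨k', l₃, hDl₃, hw, hk'⟩ := exists_along_of_v hD hY (N.pt (x₂ + a) y₀) (N.pt_notMem _ _)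
    (x + a)
  have hoff : ∀ {D : P}, D ∈ N.e → D ≠ N.X → D ∉ N.h y₀ := fun hD hX h =>
    pt_notMem_of_mem hD N.X_mem hX h (N.h_spec _).1 0 y₀ (N.pt_mem_h _ _)
  obtain ⟨g', hg'k, hg'₂, hg'Z⟩ := hP.collinear (l := N.h y₀) (m := N.e) (x₁ := N.pt x₂ y₀)
    (x₂ := N.pt (x + a) y₀) (x₃ := N.pt (x₂ + a) y₀) (y₁ := N.I) (y₂ := D) (y₃ := N.Y)
    (z₁ := N.pt (x + a) k') (z₂ := N.pt x₂ (y₀ + a)) (z₃ := Z)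
    (a₁₂ := l₂) (a₂₁ := N.d (x + a + y₀)) (a₁₃ := N.v x₂) (a₃₁ := N.d (x₂ + a + y₀))
    (a₂₃ := N.v (x + a)) (a₃₂ := l₃)
    (by simpa [pt_inj] using hxa.symm) (by simpa [pt_inj] using ha)
    (by simpa [pt_inj] using hxx₂) hI.symm N.I_ne_Y hY
    ⟨N.pt_mem_h _ _, N.pt_notMem _ _⟩ ⟨N.pt_mem_h _ _, N.pt_notMem _ _⟩
    ⟨N.pt_mem_h _ _, N.pt_notMem _ _⟩ ⟨N.I_mem, hoff N.I_mem N.I_ne_X⟩ ⟨hD, hoff hD hX⟩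
    ⟨N.Y_mem, hoff N.Y_mem N.X_ne_Y.symm⟩
    ⟨hx₂, hDl₂, hZl₂⟩ ⟨hd₂, (N.d_spec _).1, hZd⟩ ⟨N.pt_mem_v _ _, (N.v_spec _).1, N.pt_mem_v _ _⟩
    ⟨pt_mem_d_iff.2 rfl, (N.d_spec _).1, pt_mem_d_iff.2 (by abel)⟩
    ⟨N.pt_mem_v _ _, (N.v_spec _).1, N.pt_mem_v _ _⟩ ⟨hw, hDl₃, hk'⟩
  rw [line_eq_of_mem hZne hg'Z hg'₂ hgZ hg₂] at hg'k
  have := point_eq_of_mem hgv hg'k (N.pt_mem_v _ _) hg₁ (N.pt_mem_v _ _)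
  exact ⟨l₃, hDl₃, this ▸ hk', hw⟩

theorem along_translate_fst (hP : Pappian P L) {D : P} (hD : D ∈ N.e) {x x₂ k y₀ : R} (a : R)
    (h : Along L D (N.pt x k) (N.pt x₂ y₀)) : Along L D (N.pt (x + a) k) (N.pt (x₂ + a) y₀) := by
  by_cases hX : D = N.X
  · subst hX
    exact along_X_iff.2 (along_X_iff.1 h)
  by_cases hY : D = N.Y
  · subst hY
    exact along_Y_iff.2 (by rw [along_Y_iff.1 h])
  by_cases hI : D = N.I
  · subst hI
    exact along_I_iff.2 (by rw [add_right_comm, along_I_iff.1 h, add_right_comm])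
  by_cases hk : k = y₀
  · subst hk
    by_cases hx : x = x₂
    · subst hx
      exact Along.refl _ _
    · exact absurd (Along.direction_unique hD N.X_mem (by simpa [pt_inj] using hx) h
        (along_X_iff.2 rfl)) hX
  by_cases ha : a = 0
  · subst ha
    simpa using h
  by_cases hxa : x + a = x₂
  -- In the excluded case the translation is split as `k - y₀` followed by `a - (k - y₀)`. Both
  -- parts are nonzero because `D ≠ I`, and neither meets the exception again.
  · have hkz : k - y₀ ≠ 0 := sub_ne_zero.2 hk
    have hka : a ≠ k - y₀ := by
      rintro rfl
      refine hI (Along.direction_unique hD N.I_mem (by simp [pt_inj, hk]) h (along_I_iff.2 ?_))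
      rw [← hxa]
      abel
    have h' := along_translate_of_ne hP hD hX hY hI hkz hk
      (fun h => hka (add_left_cancel (hxa.trans h.symm))) h
    have h'' := along_translate_of_ne hP hD hX hY hI (sub_ne_zero.2 hka) hk
      (by rw [← hxa]; intro h; exact hkz (by simpa [add_assoc] using h)) h'
    simpa [add_assoc] using h''
  · exact along_translate_of_ne hP hD hX hY hI ha hk hxa h

theorem along_translate (hP : Pappian P L) {D : P} (hD : D ∈ N.e) {x x' y y' : R} (a b : R)
    (h : Along L D (N.pt x y) (N.pt x' y')) :
    Along L D (N.pt (x + a) (y + b)) (N.pt (x' + a) (y' + b)) := by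
  have h' := along_translate_fst (N := N.swap) hP hD b (x := y) (x₂ := y') (k := x + a)
    (y₀ := x' + a) (by rw [swap_pt, swap_pt]; exact along_translate_fst hP hD a h)
  rw [swap_pt, swap_pt] at h'
  exact h'

/-- The lines through a point at infinity other than `Y` are the graphs `y = s x + c` for an
additive map `s`. -/
theorem exists_slope (hP : Pappian P L) {D : P} (hD : D ∈ N.e) (hY : D ≠ N.Y) :
    ∃ s : R →+ R, ∀ x y c, Along L D (N.pt 0 c) (N.pt x y) ↔ y = s x + c := by
  -- The graph of `s` is the line joining `D` to the origin. Translating it by its own point `(x', s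
  -- x')` yields additivity, and translating it by `(0, c)` yields its parallels.
  choose s hs using exists_along_of_v hD hY (N.pt 0 0) (N.pt_notMem _ _)
  have key : ∀ {x y}, Along L D (N.pt 0 0) (N.pt x y) → y = s x := fun {x y} h => by
    by_contra hne
    exact hY (Along.direction_unique hD N.Y_mem (by simpa [pt_inj] using hne)
      (h.symm.trans hD (hs x)) (along_Y_iff.2 rfl))
  refine ⟨AddMonoidHom.mk' s fun x x' => ?_, fun x y c => ⟨fun h => ?_, ?_⟩⟩
  · have h := along_translate hP hD x' (s x') (hs x)
    rw [zero_add, zero_add] at h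
    exact (key ((hs x').trans hD h)).symm
  · have h' := along_translate hP hD 0 (-c) h
    simp only [add_zero, add_neg_cancel] at h'
    simp [← key h']
  · rintro rfl
    simpa using along_translate hP hD 0 c (hs x)

end NetCoordinates

/-! ### The field of slopes -/

/-- A commutative set of additive maps acting regularly on the nonzero elements is the set of
multiplications of a field. -/
theorem exists_field_of_regular {R : Type u} [AddCommGroup R] (S : R → R →+ R) {u : R} (hu : u ≠ 0)
    (hS : ∀ x, S x u = x) (hcomm : ∀ x y z, S x (S y z) = S y (S x z))
    (hsurj : ∀ x, x ≠ 0 → ∃ z, S x z = u) :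
    ∃ (F : Type u) (_ : Field F) (f : R ≃+ F), ∀ x y, f (S x y) = f x * f y := by
  classical
  -- The maps commute as operators, and `x` is recovered as `S x u`; evaluating at `u` turns this
  -- into commutativity of the product `S x y`.
  have comm : ∀ x y, S x y = S y x := fun x y => by
    conv_lhs => rw [← hS y, hcomm, hS]
  have assoc : ∀ x y z, S (S x y) z = S x (S y z) := fun x y z => by
    rw [comm _ z, hcomm, comm z y]
  have zero_left : ∀ x, S 0 x = 0 := fun x => by rw [comm, map_zero]
  let inv : R → R := fun x => if h : x = 0 then 0 else (hsurj x h).choose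
  let _ : Field R :=
    { (inferInstance : AddCommGroup R) with
      mul := fun x y => S x y
      one := u
      mul_assoc := assoc
      one_mul := fun x => (comm _ _).trans (hS x)
      mul_one := hS
      zero_mul := zero_left
      mul_zero := fun x => map_zero _
      left_distrib := fun x y z => map_add _ _ _
      right_distrib := fun x y z =>
        (comm _ _).trans ((map_add _ _ _).trans (congr_arg₂ _ (comm _ _) (comm _ _)))
      mul_comm := comm
      inv := inv
      exists_pair_ne := ⟨u, 0, hu⟩
      mul_inv_cancel := fun x hx => by
        change S x (inv x) = u
        simp only [inv, dif_neg hx]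
        exact (hsurj x hx).choose_spec
      inv_zero := dif_pos rfl
      nnqsmul := _
      nnqsmul_def := fun _ _ => rfl
      qsmul := _
      qsmul_def := fun _ _ => rfl }
  exact ⟨R, inferInstance, AddEquiv.refl R, fun x y => rfl⟩

namespace NetCoordinates

variable {P L : Type*} [Membership P L] [ProjectivePlane P L]
variable {R : Type*} [AddCommGroup R] {N : NetCoordinates P L R}

theorem Along.mem_iff {D q : P} {l : L} {x y : R} (hD : D ∈ N.e) (hDl : D ∈ l)
    (hl : N.pt x y ∈ l) : Along L D (N.pt x y) q ↔ q ∈ l := by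
  refine ⟨?_, fun h => ⟨l, hDl, hl, h⟩⟩
  rintro ⟨l', h, h', hq⟩
  rwa [line_eq_of_mem (pt_ne hD x y) hl hDl h' h]

/-- The additive map `s` is the slope of the lines through `D`. -/
def IsSlope (N : NetCoordinates P L R) (D : P) (s : R →+ R) : Prop :=
  ∀ x y c, Along L D (N.pt 0 c) (N.pt x y) ↔ y = s x + c

theorem IsSlope.along {D : P} {s : R →+ R} (hs : N.IsSlope D s) (x : R) :
    Along L D (N.pt 0 0) (N.pt x (s x)) := (hs _ _ _).2 (add_zero _).symm

theorem IsSlope.eq_zero {D : P} {s : R →+ R} (hs : N.IsSlope D s) (hD : D ∈ N.e) (hX : D ≠ N.X)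
    {x : R} (hx : s x = 0) : x = 0 := by
  by_contra hne
  refine hX (Along.direction_unique hD N.X_mem ?_ (hs.along x) (along_X_iff.2 hx.symm))
  simpa [pt_inj, eq_comm] using fun h : x = 0 => absurd h hne

theorem IsSlope.direction_eq {D E : P} {s t : R →+ R} (hs : N.IsSlope D s) (ht : N.IsSlope E t)
    (hD : D ∈ N.e) (hE : E ∈ N.e) {x : R} (hx : x ≠ 0) (h : s x = t x) : D = E :=
  Along.direction_unique hD hE (by simpa [pt_inj, eq_comm] using fun h : x = 0 => absurd h hx)
    (hs.along x) (h ▸ ht.along x)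

theorem isSlope_I : N.IsSlope N.I (-AddMonoidHom.id R) := by
  intro x y c
  rw [along_I_iff]
  simp only [zero_add, AddMonoidHom.neg_apply, AddMonoidHom.id_apply]
  constructor
  · rintro rfl
    abel
  · rintro rfl
    abel

/-- Dual Pappus for the pencils at `Y` and `X`, with concurrence at the origin. Two cross lines are
`d 0` and the line of slope `t`; the third joins `(x, s x)` to `(-t x, t (-s x))`. Passing through
the origin it has slope `s`, so `t (-s x) = s (-t x)`. The cases split off first are those where the
six lines need not be distinct. -/
theorem IsSlope.comm (hP : Pappian P L) {D E : P} {s t : R →+ R} (hs : N.IsSlope D s)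
    (ht : N.IsSlope E t) (hD : D ∈ N.e) (hE : E ∈ N.e) (hDY : D ≠ N.Y) (hEY : E ≠ N.Y) (x : R) :
    s (t x) = t (s x) := by
  have zero_of : ∀ {s : R →+ R}, N.IsSlope N.X s → ∀ x, s x = 0 := fun hs x => by
    simpa using ((hs x 0 0).1 (along_X_iff.2 rfl)).symm
  have neg_of : ∀ {s : R →+ R}, N.IsSlope N.I s → ∀ x, s x = -x := fun hs x => by
    simpa using ((hs x (-x) 0).1 (along_I_iff.2 (by simp))).symm
  by_cases hx : x = 0
  · simp [hx]
  by_cases hDX : D = N.X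
  · subst hDX
    simp [zero_of hs]
  by_cases hEX : E = N.X
  · subst hEX
    simp [zero_of ht]
  by_cases hDI : D = N.I
  · subst hDI
    simp [neg_of hs]
  by_cases hEI : E = N.I
  · subst hEI
    simp [neg_of ht]
  by_cases hDE : D = E
  · subst hDE
    have : ∀ x, s x = t x := fun x => by simpa using (ht _ _ _).1 (hs.along x)
    simp [this]
  have ha : s x ≠ 0 := fun h => hx (hs.eq_zero hD hDX h)
  have hxa : x ≠ -s x := fun h => hDI (hs.direction_eq isSlope_I hD N.I_mem hx (by
    simpa using (neg_eq_iff_eq_neg.2 h).symm))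
  have hxb : x ≠ -t x := fun h => hEI (ht.direction_eq isSlope_I hE N.I_mem hx (by
    simpa using (neg_eq_iff_eq_neg.2 h).symm))
  have hab : s x ≠ t x := fun h => hDE (hs.direction_eq ht hD hE hx h)
  have hwa : t (-s x) ≠ s x := fun h =>
    hEI (ht.direction_eq isSlope_I hE N.I_mem (neg_ne_zero.2 ha) (by simpa using h))
  have hwb : t (-s x) ≠ t x := fun h => hxa <| by
    have := ht.eq_zero hE hEX (x := -s x - x) (by rw [map_sub, h, sub_self])
    exact (sub_eq_zero.1 this).symm
  obtain ⟨lE, hElE, hOlE, hpE⟩ := ht.along x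
  obtain ⟨lD, hDlD, hOlD, hpD⟩ := hs.along x
  have hpE' : N.pt (-s x) (t (-s x)) ∈ lE := (Along.mem_iff hE hElE hOlE).1 (ht.along _)
  have hYv : ∀ x, N.Y ∈ N.v x ∧ N.X ∉ N.v x := fun x => ⟨(N.v_spec x).1, fun h =>
    pt_notMem_of_mem N.X_mem N.Y_mem N.X_ne_Y h (N.v_spec x).1 x 0 (N.pt_mem_v _ _)⟩
  have hXh : ∀ y, N.X ∈ N.h y ∧ N.Y ∉ N.h y := fun y => ⟨(N.h_spec y).1, fun h =>
    pt_notMem_of_mem N.X_mem N.Y_mem N.X_ne_Y (N.h_spec y).1 h 0 y (N.pt_mem_h _ _)⟩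
  obtain ⟨w, hw, hw'⟩ := exists_line_mem_mem (L := L) (N.pt x (s x)) (N.pt (-t x) (t (-s x)))
  have hOw : N.pt 0 0 ∈ w := hP.concurrent (u₁ := N.v x) (u₂ := N.v (-t x)) (u₃ := N.v (-s x))
    (v₁ := N.h (t (-s x))) (v₂ := N.h (s x)) (v₃ := N.h (t x)) (w₁ := N.d 0) (w₂ := lE)
    (N.v_injective.ne hxb) (N.v_injective.ne hxa)
    (N.v_injective.ne fun h => hab (neg_injective h).symm)
    (N.h_injective.ne hwa) (N.h_injective.ne hwb) (N.h_injective.ne hab)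
    (hYv _) (hYv _) (hYv _) (hXh _) (hXh _) (hXh _)
    ⟨N.pt_mem_v _ _, N.pt_mem_h _ _, hw⟩ ⟨N.pt_mem_v _ _, N.pt_mem_h _ _, hw'⟩
    ⟨N.pt_mem_v _ _, N.pt_mem_h _ _, hpE⟩ ⟨N.pt_mem_v _ _, N.pt_mem_h _ _, hpE'⟩
    ⟨N.pt_mem_v _ _, N.pt_mem_h _ _, pt_mem_d_iff.2 (by simp)⟩
    ⟨N.pt_mem_v _ _, N.pt_mem_h _ _, pt_mem_d_iff.2 (by simp)⟩ (pt_mem_d_iff.2 (by simp)) hOlE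
  have hne : N.pt x (s x) ≠ N.pt 0 0 := by simp [pt_inj, hx]
  rw [line_eq_of_mem hne hw hOw hpD hOlD] at hw'
  have := (hs _ _ _).1 ((Along.mem_iff hD hDlD hOlD).2 hw')
  simpa using this.symm

end NetCoordinates

namespace NetCoordinates

variable {P L : Type*} [Membership P L] [ProjectivePlane P L]
variable {R : Type*} [AddCommGroup R] {N : NetCoordinates P L R}

/-- Were `R` trivial, the line `h 0` would have only two points, `X` and the origin. -/
theorem exists_pt_fst_ne_zero [Finite P] [Finite L] (N : NetCoordinates P L R) :
    ∃ u : R, u ≠ 0 := by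
  have h := ProjectivePlane.two_lt_pointCount P (N.h 0)
  have := Fintype.ofFinite {p : P // p ∈ N.h 0}
  rw [pointCount, Nat.card_eq_fintype_card, Fintype.two_lt_card_iff] at h
  by_contra! hR
  have key : ∀ p ∈ N.h 0, p = N.X ∨ p = N.pt 0 0 := by
    intro p hp
    by_cases hpe : p ∈ N.e
    · exact Or.inl (point_eq_of_mem (N.h_spec 0).2 hp hpe (N.h_spec 0).1 N.X_mem)
    · obtain ⟨x, y, rfl⟩ := exists_pt hpe
      rw [hR x, hR y]
      exact Or.inr rfl
  obtain ⟨⟨a, ha⟩, ⟨b, hb⟩, ⟨c, hc⟩, hab, hac, hbc⟩ := h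
  simp only [ne_eq, Subtype.mk.injEq] at hab hac hbc
  rcases key a ha with rfl | rfl <;> rcases key b hb with rfl | rfl <;>
    rcases key c hc with rfl | rfl <;> contradiction

end NetCoordinates

/-! ### Homogeneous coordinates of a Pappian plane -/

/-- Homogeneous coordinates: `f` and `g` assign to points and lines nonzero vectors in `F³`, such
that incidence is orthogonality and every vector is a multiple of one assigned to a point. -/
structure HomogeneousCoordinates (P L F : Type*) [Membership P L] [Field F] where
  f : P → Fin 3 → F
  g : L → Fin 3 → F
  f_ne_zero : ∀ p, f p ≠ 0
  g_ne_zero : ∀ l, g l ≠ 0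
  mem_iff : ∀ p l, p ∈ l ↔ f p ⬝ᵥ g l = 0
  exists_smul : ∀ w, w ≠ 0 → ∃ p, ∃ c : F, w = c • f p

-- A slope is named by its value at `u`. The point `(x, y)` gets the vector (1, x, y), the ideal
-- point of slope m gets (0, 1, m) and `Y` gets (0, 0, 1). The line y = m x + c gets (c, m, -1), the
-- vertical line at c gets (c, -1, 0) and `e` gets (1, 0, 0).
open NetCoordinates in
theorem Pappian.exists_homogeneousCoordinates {P : Type u} {L : Type*} [Membership P L]
    [ProjectivePlane P L] [Finite P] [Finite L] (hP : Pappian P L) :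
    ∃ (F : Type u) (_ : Field F), Nonempty (HomogeneousCoordinates P L F) := by
  obtain ⟨R, _, ⟨N⟩⟩ : ∃ (R : Type u) (_ : AddCommGroup R), Nonempty (NetCoordinates P L R) := by
    obtain ⟨-, -, -, e, -⟩ := @ProjectivePlane.exists_config P L _ _
    obtain ⟨X, Y, I, hX, hY, hI, hXY, hIX, hIY⟩ : ∃ X Y I : P, X ∈ e ∧ Y ∈ e ∧ I ∈ e ∧ X ≠ Y ∧
        I ≠ X ∧ I ≠ Y := by
      have h := ProjectivePlane.two_lt_pointCount P e
      have := Fintype.ofFinite {p : P // p ∈ e}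
      rw [pointCount, Nat.card_eq_fintype_card, Fintype.two_lt_card_iff] at h
      obtain ⟨⟨a, ha⟩, ⟨b, hb⟩, ⟨c, hc⟩, hab, hac, hbc⟩ := h
      simp only [ne_eq, Subtype.mk.injEq] at hab hac hbc
      exact ⟨a, b, c, ha, hb, hc, hab, Ne.symm hac, Ne.symm hbc⟩
    obtain ⟨k, ⟨eqv⟩⟩ := Finite.exists_equiv_fin {l : L // I ∈ l ∧ l ≠ e}
    -- Labelling by a lifted `Fin k` keeps `R`, and hence the field, in the universe of the points,
    -- as `IsFieldPlane` requires.
    obtain ⟨inst, N, -⟩ := hP.exists_netCoordinates (R := ULift.{u} (Fin k)) hX hY hI hXY hIX hIY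
      (Equiv.ulift.trans eqv.symm)
    exact ⟨_, inst, ⟨N⟩⟩
  obtain ⟨u, hu⟩ := N.exists_pt_fst_ne_zero
  have hdir : ∀ m : R, ∃ D : P, ∃ s : R →+ R, D ∈ N.e ∧ D ≠ N.Y ∧ N.IsSlope D s ∧ s u = m := by
    intro m
    have hne : N.pt 0 0 ≠ N.pt u m := by simp [pt_inj, hu.symm]
    obtain ⟨l, hl₀, hl⟩ := exists_line_mem_mem (L := L) (N.pt 0 0) (N.pt u m)
    have hle : l ≠ N.e := by
      rintro rfl
      exact N.pt_notMem _ _ hl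
    obtain ⟨D, hDl, hDe⟩ := exists_point_mem_mem (P := P) hle
    have hDY : D ≠ N.Y := by
      rintro rfl
      exact hu ((along_Y_iff.1 ⟨l, hDl, hl₀, hl⟩).symm)
    obtain ⟨s, hs⟩ := exists_slope hP hDe hDY
    exact ⟨D, s, hDe, hDY, hs, by simpa using ((hs _ _ _).1 ⟨l, hDl, hl₀, hl⟩).symm⟩
  choose dir S dir_mem dir_ne slope hSu using hdir
  -- A nonzero slope has an inverse because its line through the origin, not passing through `X`,
  -- meets `h u`.
  obtain ⟨F, _, φ, hφ⟩ := exists_field_of_regular S hu hSu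
    (fun x y z => (slope x).comm hP (slope y) (dir_mem _) (dir_mem _) (dir_ne _) (dir_ne _) z)
    (fun x hx => by
      have hX : dir x ≠ N.X := by
        intro h
        have := (slope x u 0 0).1 (by rw [h]; exact along_X_iff.2 rfl)
        exact hx (by simpa [hSu] using this.symm)
      obtain ⟨z, hz⟩ := exists_along_of_h (dir_mem x) hX (N.pt 0 0) (N.pt_notMem _ _) u
      exact ⟨z, by simpa using ((slope x _ _ _).1 hz).symm⟩)
  have dir_inj : ∀ m m', dir m = dir m' ↔ m = m' := by
    refine fun m m' => ⟨fun h => ?_, fun h => h ▸ rfl⟩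
    have := (slope m' u (S m u) 0).1 (by rw [← h]; exact (slope m).along u)
    simpa [hSu] using this
  have dir_surj : ∀ D ∈ N.e, D ≠ N.Y → ∃ m, D = dir m := by
    intro D hD hDY
    obtain ⟨m, hm⟩ := exists_along_of_v hD hDY (N.pt 0 0) (N.pt_notMem _ _) u
    exact ⟨m, Along.direction_unique hD (dir_mem m) (by simp [pt_inj, hu.symm]) hm
      (by simpa [hSu] using (slope m).along u)⟩
  have hpt : ∀ p : P, ∃ w : Fin 3 → F, (∃ x y, p = N.pt x y ∧ w = ![1, φ x, φ y]) ∨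
      (∃ m, p = dir m ∧ w = ![0, 1, φ m]) ∨ (p = N.Y ∧ w = ![0, 0, 1]) := by
    intro p
    by_cases hpe : p ∈ N.e
    · by_cases hpY : p = N.Y
      · exact ⟨_, Or.inr (Or.inr ⟨hpY, rfl⟩)⟩
      · obtain ⟨m, hm⟩ := dir_surj p hpe hpY
        exact ⟨_, Or.inr (Or.inl ⟨m, hm, rfl⟩)⟩
    · obtain ⟨x, y, hxy⟩ := exists_pt hpe
      exact ⟨_, Or.inl ⟨x, y, hxy, rfl⟩⟩
  have hln : ∀ l : L, ∃ w : Fin 3 → F,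
      (∃ m c, (dir m ∈ l ∧ N.pt 0 c ∈ l) ∧ w = ![φ c, φ m, -1]) ∨
      (∃ c, l = N.v c ∧ w = ![φ c, -1, 0]) ∨ (l = N.e ∧ w = ![1, 0, 0]) := by
    intro l
    by_cases hle : l = N.e
    · exact ⟨_, Or.inr (Or.inr ⟨hle, rfl⟩)⟩
    by_cases hlY : N.Y ∈ l
    · obtain ⟨c, hc⟩ := N.v_surjective l hlY hle
      exact ⟨_, Or.inr (Or.inl ⟨c, hc.symm, rfl⟩)⟩
    obtain ⟨D, hDl, hDe⟩ := exists_point_mem_mem (P := P) hle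
    have hDY : D ≠ N.Y := by
      rintro rfl
      exact hlY hDl
    obtain ⟨q, hql, hq⟩ := exists_point_mem_mem (P := P) (l := l) (m := N.v 0) (by
      rintro rfl
      exact hlY (N.v_spec 0).1)
    have hqe : q ∉ N.e := by
      intro hqe
      obtain rfl := point_eq_of_mem hle hDl hDe hql hqe
      exact hDY (point_eq_of_mem (N.v_spec 0).2 hq hqe (N.v_spec 0).1 N.Y_mem)
    obtain ⟨x, c, rfl⟩ := exists_pt hqe
    obtain rfl := pt_mem_v_iff.1 hq
    obtain ⟨m, rfl⟩ := dir_surj D hDe hDY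
    exact ⟨_, Or.inl ⟨m, c, ⟨hDl, hql⟩, rfl⟩⟩
  choose f hf using hpt
  choose g hg using hln
  have f_pt : ∀ x y, f (N.pt x y) = ![1, φ x, φ y] := by
    intro x y
    rcases hf (N.pt x y) with ⟨x', y', h, hw⟩ | ⟨m, h, hw⟩ | ⟨h, hw⟩
    · obtain ⟨rfl, rfl⟩ := pt_inj.1 h
      exact hw
    · exact absurd h (pt_ne (dir_mem m) _ _)
    · exact absurd h (pt_ne N.Y_mem _ _)
  have f_dir : ∀ m, f (dir m) = ![0, 1, φ m] := by
    intro m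
    rcases hf (dir m) with ⟨x', y', h, hw⟩ | ⟨m', h, hw⟩ | ⟨h, hw⟩
    · exact absurd h.symm (pt_ne (dir_mem m) _ _)
    · rw [hw, (dir_inj _ _).1 h]
    · exact absurd h (dir_ne m)
  have f_Y : f N.Y = ![0, 0, 1] := by
    rcases hf N.Y with ⟨x', y', h, hw⟩ | ⟨m', h, hw⟩ | ⟨h, hw⟩
    · exact absurd h.symm (pt_ne N.Y_mem _ _)
    · exact absurd h.symm (dir_ne m')
    · exact hw
  refine ⟨F, inferInstance, ⟨f, g, ?_, ?_, ?_, ?_⟩⟩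
  · intro p h
    rcases hf p with ⟨x, y, -, hw⟩ | ⟨m, -, hw⟩ | ⟨-, hw⟩ <;> simp [hw] at h
  · intro l h
    rcases hg l with ⟨x, y, -, hw⟩ | ⟨m, -, hw⟩ | ⟨-, hw⟩ <;> simp [hw] at h
  · intro p l
    rcases hg l with ⟨m, c, ⟨hm, hc⟩, hw⟩ | ⟨c, rfl, hw⟩ | ⟨rfl, hw⟩
    · rw [hw]
      have hle : l ≠ N.e := by
        rintro rfl
        exact N.pt_notMem _ _ hc
      rcases hf p with ⟨x, y, rfl, -⟩ | ⟨m', rfl, -⟩ | ⟨rfl, -⟩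
      · rw [f_pt, ← Along.mem_iff (dir_mem m) hm hc, slope m x y c, ← φ.injective.eq_iff, map_add,
          hφ]
        simp only [Matrix.vec3_dotProduct, Matrix.cons_val]
        constructor
        · intro h
          rw [h]
          ring
        · intro h
          linear_combination -h
      · rw [f_dir]
        simp only [Matrix.vec3_dotProduct, Matrix.cons_val]
        rw [show (0 : F) * φ c + 1 * φ m + φ m' * -1 = φ m - φ m' by ring, sub_eq_zero,
          φ.injective.eq_iff, ← dir_inj]
        exact ⟨fun h => point_eq_of_mem hle hm (dir_mem _) h (dir_mem _), fun h => h ▸ hm⟩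
      · rw [f_Y]
        simp only [Matrix.vec3_dotProduct, Matrix.cons_val]
        simpa using fun h => dir_ne m (point_eq_of_mem hle hm (dir_mem _) h N.Y_mem)
    · rw [hw]
      rcases hf p with ⟨x, y, rfl, -⟩ | ⟨m', rfl, -⟩ | ⟨rfl, -⟩
      · rw [f_pt, pt_mem_v_iff]
        simp only [Matrix.vec3_dotProduct, Matrix.cons_val]
        rw [show (1 : F) * φ c + φ x * -1 + φ y * 0 = φ c - φ x by ring, sub_eq_zero,
          φ.injective.eq_iff, eq_comm]
      · rw [f_dir]
        simp only [Matrix.vec3_dotProduct, Matrix.cons_val]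
        simpa using fun h => dir_ne m' (point_eq_of_mem (N.v_spec c).2 h (dir_mem _)
          (N.v_spec c).1 N.Y_mem)
      · rw [f_Y]
        simpa using (N.v_spec c).1
    · rw [hw]
      rcases hf p with ⟨x, y, rfl, -⟩ | ⟨m', rfl, -⟩ | ⟨rfl, -⟩
      · rw [f_pt]
        simpa using N.pt_notMem x y
      · rw [f_dir]
        simpa using dir_mem m'
      · rw [f_Y]
        simpa using N.Y_mem
  · intro w hw
    by_cases h₀ : w 0 = 0
    · by_cases h₁ : w 1 = 0
      · refine ⟨N.Y, w 2, ?_⟩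
        rw [f_Y]
        ext i
        fin_cases i <;> simp [h₀, h₁]
      · refine ⟨dir (φ.symm (w 2 / w 1)), w 1, ?_⟩
        rw [f_dir]
        ext i
        fin_cases i <;> simp [h₀, mul_div_cancel₀, h₁]
    · refine ⟨N.pt (φ.symm (w 1 / w 0)) (φ.symm (w 2 / w 0)), w 0, ?_⟩
      rw [f_pt]
      ext i
      fin_cases i <;> simp [h₀, mul_div_cancel₀]

/-! ### Isomorphisms as injective images -/

namespace IncidenceSystem

variable {α β : Type*}

/-- The image of an incidence system under a map of points. -/
def map (f : α → β) (X : IncidenceSystem α) : IncidenceSystem β where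
  points := f '' X.points
  lines := (f '' ·) '' X.lines
  subset_points := by
    rintro _ ⟨l, hl, rfl⟩
    exact Set.image_mono (X.subset_points l hl)

theorem isomorphic_map {f : α → β} (hf : Function.Injective f) (X : IncidenceSystem α) :
    Isomorphic X (X.map f) := by
  refine ⟨⟨fun x => ⟨f x, x, x.2, rfl⟩, fun l => ⟨f '' l, l, l.2, rfl⟩,
    fun x l h => ⟨x, h, rfl⟩⟩, ⟨?_, ?_⟩, ⟨?_, ?_⟩⟩
  · intro x y h
    exact Subtype.ext (hf (congr_arg Subtype.val h))
  · rintro ⟨_, x, hx, rfl⟩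
    exact ⟨⟨x, hx⟩, rfl⟩
  · intro x y h
    exact Subtype.ext (hf.image_injective (congr_arg Subtype.val h))
  · rintro ⟨_, x, hx, rfl⟩
    exact ⟨⟨x, hx⟩, rfl⟩

/-- Two distinct points lie on at most one line. -/
def IsPartialLinear (X : IncidenceSystem α) : Prop :=
  ∀ l ∈ X.lines, ∀ m ∈ X.lines, ∀ p ∈ l, ∀ q ∈ l, p ∈ m → q ∈ m → p ≠ q → l = m

/-- An isomorphism onto a partial linear space reflects incidence as soon as every point off a
line is collinear with some point of the line. -/
theorem Isomorphic.exists_eq_map {X : IncidenceSystem α} {Y : IncidenceSystem β}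
    (h : Isomorphic X Y) (hX : X.points = Set.univ)
    (hXc : ∀ l ∈ X.lines, ∀ p, ∃ q ∈ l, ∃ m ∈ X.lines, p ∈ m ∧ q ∈ m) (hY : Y.IsPartialLinear) :
    ∃ f : α → β, Function.Injective f ∧ Y = X.map f := by
  obtain ⟨φ, hp, hl⟩ := h
  have hmem : ∀ a, a ∈ X.points := by simp [hX]
  let f : α → β := fun a => φ.onPoints ⟨a, hmem a⟩
  have hf : Function.Injective f := fun a b h =>
    congr_arg Subtype.val (hp.1 (Subtype.ext h))
  have himage : ∀ l : X.lines, (φ.onLines l : Set β) = f '' l := by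
    intro l
    ext b
    constructor
    · intro hb
      obtain ⟨⟨a, ha⟩, hab⟩ := hp.2 ⟨b, Y.subset_points _ (φ.onLines l).2 hb⟩
      have hab' : f a = b := congr_arg Subtype.val hab
      refine ⟨a, ?_, hab'⟩
      by_contra hal
      -- The images of `l` and of the join `m` share two distinct points, so they coincide;
      -- injectivity on lines gives `l = m`, which contains `a`.
      obtain ⟨q, hq, m, hm, ham, hqm⟩ := hXc l l.2 a
      have hne : f a ≠ f q := hf.ne (by rintro rfl; exact hal hq)
      have := hY _ (φ.onLines l).2 _ (φ.onLines ⟨m, hm⟩).2 (f a) (hab' ▸ hb) (f q)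
        (φ.mem_of_mem ⟨q, hmem q⟩ l hq) (φ.mem_of_mem ⟨a, hmem a⟩ ⟨m, hm⟩ ham)
        (φ.mem_of_mem ⟨q, hmem q⟩ ⟨m, hm⟩ hqm) hne
      have := hl.1 (Subtype.ext this)
      exact hal (this ▸ ham)
    · rintro ⟨a, ha, rfl⟩
      exact φ.mem_of_mem ⟨a, hmem a⟩ l ha
  refine ⟨f, hf, IncidenceSystem.ext ?_ ?_⟩
  · ext b
    constructor
    · intro hb
      obtain ⟨a, ha⟩ := hp.2 ⟨b, hb⟩
      exact ⟨a, a.2, congr_arg Subtype.val ha⟩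
    · rintro ⟨a, -, rfl⟩
      exact (φ.onPoints _).2
  · ext s
    constructor
    · intro hs
      obtain ⟨l, hl⟩ := hl.2 ⟨s, hs⟩
      exact ⟨l, l.2, (himage l).symm.trans (congr_arg Subtype.val hl)⟩
    · rintro ⟨l, hl, rfl⟩
      change f '' l ∈ Y.lines
      rw [← himage ⟨l, hl⟩]
      exact (φ.onLines _).2

theorem isPartialLinear_ofConfiguration (P L : Type*) [Membership P L] [Nondegenerate P L] :
    (ofConfiguration P L).IsPartialLinear := by
  rintro _ ⟨l, rfl⟩ _ ⟨m, rfl⟩ p hpl q hql hpm hqm hpq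
  rw [(Nondegenerate.eq_or_eq (P := P) (L := L) hpl hql hpm hqm).resolve_left hpq]

end IncidenceSystem

/-! ### Field planes and Pappus's theorem in coordinates -/

section Linear

variable {F : Type*} [Field F]

/-- The vectors orthogonal to `w`. -/
def orthogonalTo (w : Fin 3 → F) : Submodule F (Fin 3 → F) :=
  LinearMap.ker (dotProductEquiv F (Fin 3) w)

theorem finrank_orthogonalTo {w : Fin 3 → F} (hw : w ≠ 0) :
    Module.finrank F (orthogonalTo w) = 2 := by
  have h := Module.Dual.finrank_ker_add_one_of_ne_zero (f := dotProductEquiv F (Fin 3) w)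
    (by simpa using hw)
  rw [Module.finrank_fin_fun] at h
  exact Nat.succ.inj h

theorem mem_orthogonalTo {v w : Fin 3 → F} : v ∈ orthogonalTo w ↔ v ⬝ᵥ w = 0 := by
  rw [orthogonalTo, LinearMap.mem_ker, dotProductEquiv_apply_apply, dotProduct_comm]

theorem exists_eq_orthogonalTo {W : Submodule F (Fin 3 → F)} (hW : Module.finrank F W = 2) :
    ∃ w, w ≠ 0 ∧ W = orthogonalTo w := by
  have hlt : W < ⊤ := by
    rw [lt_top_iff_ne_top]
    rintro rfl
    simp at hW
  obtain ⟨f, hf, hWf⟩ := Submodule.exists_le_ker_of_lt_top W hlt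
  obtain ⟨w, rfl⟩ := (dotProductEquiv F (Fin 3)).surjective f
  have hw : w ≠ 0 := by
    rintro rfl
    simp at hf
  exact ⟨w, hw, Submodule.eq_of_le_of_finrank_eq hWf (hW.trans (finrank_orthogonalTo hw).symm)⟩

theorem finrank_span_pair_eq_two {a b : Fin 3 → F} (h : LinearIndependent F ![a, b]) : Module.finrank F (Submodule.span F {a, b}) = 2 := by
  rw [← Matrix.range_cons_cons_empty a b ![], finrank_span_eq_card h, Fintype.card_fin]

theorem eq_span_pair {W : Submodule F (Fin 3 → F)} (hW : Module.finrank F W = 2)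
    {a b : Fin 3 → F} (h : LinearIndependent F ![a, b]) (ha : a ∈ W) (hb : b ∈ W) : W = Submodule.span F {a, b} := by
  refine (Submodule.eq_of_le_of_finrank_eq (Submodule.span_le.2 ?_)
    ((finrank_span_pair_eq_two h).trans hW.symm)).symm
  rintro x (rfl | rfl) <;> assumption

end Linear

namespace HomogeneousCoordinates

variable {P L : Type*} [Membership P L] [ProjectivePlane P L]
variable {F : Type*} [Field F] (H : HomogeneousCoordinates P L F)

theorem eq_of_eq_smul {p q : P} {c : F} (h : H.f p = c • H.f q) : p = q := by
  by_contra hpq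
  obtain ⟨l, hpl, hql⟩ := exists_line_mem_mem (L := L) p q
  obtain ⟨r, hr⟩ := Nondegenerate.exists_point (P := P) l
  obtain ⟨m, hqm, hrm⟩ := exists_line_mem_mem (L := L) q r
  have hpm : p ∈ m := by
    rw [H.mem_iff, h, smul_dotProduct, (H.mem_iff q m).1 hqm, smul_zero]
  exact hr (line_eq_of_mem hpq hpl hql hpm hqm ▸ hrm)

theorem linearIndependent_pair {p q : P} (h : p ≠ q) : LinearIndependent F ![H.f p, H.f q] := by
  rw [LinearIndependent.pair_iff' (H.f_ne_zero p)]
  intro a ha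
  exact h (H.eq_of_eq_smul ha.symm).symm

theorem exists_eq_add_smul {l : L} {p q x : P} (hp : p ∈ l) (hq : q ∈ l) (hx : x ∈ l)
    (hpq : p ≠ q) : ∃ a b : F, a • H.f p + b • H.f q = H.f x := by
  rw [H.mem_iff, ← mem_orthogonalTo] at hp hq hx
  rwa [eq_span_pair (finrank_orthogonalTo (H.g_ne_zero l)) (H.linearIndependent_pair hpq)
    hp hq, Submodule.mem_span_pair] at hx

theorem exists_line_of_finrank {W : Submodule F (Fin 3 → F)} (hW : Module.finrank F W = 2) :
    ∃ l : L, W = orthogonalTo (H.g l) := by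
  let b := Module.finBasisOfFinrankEq F W hW
  have hb : ∀ i, (b i : Fin 3 → F) ≠ 0 := fun i => by simpa using b.ne_zero i
  obtain ⟨p, c, hp⟩ := H.exists_smul _ (hb 0)
  obtain ⟨q, d, hq⟩ := H.exists_smul _ (hb 1)
  have hc : c ≠ 0 := by
    rintro rfl
    exact hb 0 (by simpa using hp)
  have hd : d ≠ 0 := by
    rintro rfl
    exact hb 1 (by simpa using hq)
  have hpW : H.f p ∈ W := by
    rw [← inv_smul_smul₀ hc (H.f p), ← hp]
    exact W.smul_mem _ (b 0).2
  have hqW : H.f q ∈ W := by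
    rw [← inv_smul_smul₀ hd (H.f q), ← hq]
    exact W.smul_mem _ (b 1).2
  have hpq : p ≠ q := by
    rintro rfl
    have h : d • b 0 = c • b 1 := by
      apply Subtype.ext
      simp [hp, hq, smul_smul, mul_comm]
    have := congr_arg (fun w => b.repr w 0) h
    simp [hd] at this
  obtain ⟨l, hpl, hql⟩ := exists_line_mem_mem (L := L) p q
  rw [H.mem_iff, ← mem_orthogonalTo] at hpl hql
  refine ⟨l, ?_⟩
  rw [eq_span_pair hW (H.linearIndependent_pair hpq) hpW hqW,
    eq_span_pair (finrank_orthogonalTo (H.g_ne_zero l)) (H.linearIndependent_pair hpq)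
      hpl hql]

open scoped LinearAlgebra.Projectivization in
/-- The identification of the points with the points of `PG(2, F)`. -/
noncomputable def equiv : P ≃ ℙ F (Fin 3 → F) :=
  Equiv.ofBijective (fun p => Projectivization.mk F (H.f p) (H.f_ne_zero p)) <| by
    constructor
    · intro p q h
      obtain ⟨c, hc⟩ := (Projectivization.mk_eq_mk_iff' F _ _ _ _).1 h
      exact H.eq_of_eq_smul hc.symm
    · intro w
      induction w using Projectivization.ind with
      | h w hw =>
        obtain ⟨p, c, hp⟩ := H.exists_smul w hw
        refine ⟨p, ((Projectivization.mk_eq_mk_iff' F _ _ _ _).2 ⟨c, hp.symm⟩).symm⟩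

theorem equiv_submodule_le {p : P} {W : Submodule F (Fin 3 → F)} :
    (H.equiv p).submodule ≤ W ↔ H.f p ∈ W := by
  change (Projectivization.mk F (H.f p) (H.f_ne_zero p)).submodule ≤ W ↔ _
  rw [Projectivization.submodule_mk, Submodule.span_singleton_le_iff_mem]

theorem isomorphic_fieldPlane (H : HomogeneousCoordinates P L F) :
    (IncidenceSystem.fieldPlane F).Isomorphic (IncidenceSystem.ofConfiguration P L) := by
  have h : IncidenceSystem.ofConfiguration P L =
      (IncidenceSystem.fieldPlane F).map H.equiv.symm := by
    have himage : ∀ W : Submodule F (Fin 3 → F),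
        H.equiv.symm '' {q | q.submodule ≤ W} = {p | H.f p ∈ W} := by
      intro W
      ext p
      rw [Equiv.image_symm_eq_preimage, Set.mem_preimage, Set.mem_ofPred_eq, Set.mem_ofPred_eq,
        H.equiv_submodule_le]
    refine IncidenceSystem.ext ?_ ?_
    · simp [IncidenceSystem.ofConfiguration, IncidenceSystem.map, IncidenceSystem.fieldPlane]
    · ext s
      constructor
      · rintro ⟨l, rfl⟩
        refine ⟨_, ⟨_, finrank_orthogonalTo (H.g_ne_zero l), rfl⟩, ?_⟩
        simp only [himage, mem_orthogonalTo, H.mem_iff]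
      · rintro ⟨_, ⟨W, hW, rfl⟩, rfl⟩
        obtain ⟨l, rfl⟩ := H.exists_line_of_finrank hW
        refine ⟨l, ?_⟩
        simp only [himage, mem_orthogonalTo, H.mem_iff]
  rw [h]
  exact IncidenceSystem.isomorphic_map H.equiv.symm.injective _

/-- With `O` the common point of `l` and `m`, vectors of `x i` and `y i` may be scaled to `a i • O +
x 0` and `c i • O + y 0`. Then `w i j` is a combination of `x i`, `y j` and also of `x j`, `y i`, so
it represents their cross join. Each coefficient of `w i j` is a difference of an i-term and a
j-term, so the cyclic sum vanishes and the cross joins are dependent. -/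
theorem pappian (H : HomogeneousCoordinates P L F) : Pappian P L := by
  intro l m x y z hx hy hxl hym hz
  have hlm : l ≠ m := by
    rintro rfl
    exact (hxl 0).2 (hxl 0).1
  obtain ⟨O, hOl, hOm⟩ := exists_point_mem_mem (P := P) hlm
  have coords : ∀ {l : L} {x : Fin 3 → P}, O ∈ l → (∀ i, x i ∈ l) → (∀ i, x i ≠ O) →
      ∀ i, ∃ a b : F, b ≠ 0 ∧ b • H.f (x i) = a • H.f O + H.f (x 0) := by
    intro l x hO hx hxO i
    obtain ⟨a, b, h⟩ := H.exists_eq_add_smul hO (hx 0) (hx i) (hxO 0).symm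
    have hb : b ≠ 0 := by
      rintro rfl
      exact hxO i (H.eq_of_eq_smul (c := a) (by simp [← h]))
    refine ⟨b⁻¹ * a, b⁻¹, inv_ne_zero hb, ?_⟩
    rw [← h, smul_add, smul_smul, inv_smul_smul₀ hb]
  choose a α hα ha using coords hOl (fun i => (hxl i).1)
    (fun i h => (hxl i).2 (h ▸ hOm))
  choose c γ hγ hc using coords hOm (fun i => (hym i).1)
    (fun i h => (hym i).2 (h ▸ hOl))
  have ha_inj : ∀ i j, i ≠ j → a i - a j ≠ 0 := by
    intro i j hij h
    have h' := ha i
    rw [sub_eq_zero.1 h, ← ha j] at h'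
    refine hij (hx (H.eq_of_eq_smul (c := (α i)⁻¹ * α j) ?_))
    rw [mul_smul, ← h', inv_smul_smul₀ (hα i)]
  let w : Fin 3 → Fin 3 → Fin 3 → F := fun i j => (c i - c j) • H.f (x 0) +
    (a i - a j) • H.f (y 0) + (a i * c i - a j * c j) • H.f O
  have mem_smul : ∀ {p : P} {l : L} {b : F}, p ∈ l → (b • H.f p) ⬝ᵥ H.g l = 0 := by
    intro p l b hp
    rw [smul_dotProduct, (H.mem_iff p l).1 hp, smul_zero]
  have hw : ∀ i j k, i ≠ j → i ≠ k → j ≠ k → ∃ b : F, b ≠ 0 ∧ w i j = b • H.f (z k) := by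
    intro i j k hij hik hjk
    have hw₀ : w i j ≠ 0 := by
      intro h
      refine (hym 0).2 ((H.mem_iff _ l).2 ?_)
      have h' := congr_arg (· ⬝ᵥ H.g l) h
      simp only [w, add_dotProduct, mem_smul (hxl 0).1, mem_smul hOl, smul_dotProduct, smul_eq_mul,
        zero_add, add_zero, zero_dotProduct] at h'
      exact (mul_eq_zero.1 h').resolve_left (ha_inj i j hij)
    obtain ⟨q, b, hb⟩ := H.exists_smul _ hw₀
    have hb₀ : b ≠ 0 := by
      rintro rfl
      exact hw₀ (by simpa using hb)
    obtain ⟨s, hxs, hys, hzs⟩ := hz i j k hij hik hjk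
    obtain ⟨t, hxt, hyt, hzt⟩ := hz j i k hij.symm hjk hik
    have hst : s ≠ t := by
      rintro rfl
      have := line_eq_of_mem (hx.ne hij) hxs hxt (hxl i).1 (hxl j).1
      exact (hym j).2 (this ▸ hys)
    have mem_of : ∀ {r : L} (e₁ e₂ : F) {i' j' : Fin 3}, x i' ∈ r → y j' ∈ r →
        w i j = (e₁ * α i') • H.f (x i') + (e₂ * γ j') • H.f (y j') → q ∈ r := by
      intro r e₁ e₂ i' j' hi hj h
      rw [H.mem_iff]
      have : (b • H.f q) ⬝ᵥ H.g r = 0 := by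
        rw [← hb, h, add_dotProduct, mem_smul hi, mem_smul hj, add_zero]
      rw [smul_dotProduct, smul_eq_mul] at this
      exact (mul_eq_zero.1 this).resolve_left hb₀
    have hqs : q ∈ s := mem_of (c i - c j) (a i - a j) hxs hys (by
      rw [mul_smul, mul_smul, ha, hc]
      simp only [w]
      module)
    have hqt : q ∈ t := mem_of (c i - c j) (a i - a j) hxt hyt (by
      rw [mul_smul, mul_smul, ha, hc]
      simp only [w]
      module)
    obtain rfl := point_eq_of_mem hst hqs hqt hzs hzt
    exact ⟨b, hb₀, hb⟩
  obtain ⟨h, h₀, h₁⟩ := exists_line_mem_mem (L := L) (z 0) (z 1)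
  obtain ⟨b₀, -, hb₀⟩ := hw 1 2 0 (by decide) (by decide) (by decide)
  obtain ⟨b₁, -, hb₁⟩ := hw 2 0 1 (by decide) (by decide) (by decide)
  obtain ⟨b₂, hb, hb₂⟩ := hw 0 1 2 (by decide) (by decide) (by decide)
  have h₂ : z 2 ∈ h := by
    rw [H.mem_iff]
    have hsum : b₂ • H.f (z 2) = (-b₀) • H.f (z 0) + (-b₁) • H.f (z 1) := by
      rw [neg_smul, neg_smul, ← hb₀, ← hb₁, ← hb₂]
      simp only [w]
      module
    have : (b₂ • H.f (z 2)) ⬝ᵥ H.g h = 0 := by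
      rw [hsum, add_dotProduct, mem_smul h₀, mem_smul h₁, add_zero]
    rw [smul_dotProduct, smul_eq_mul] at this
    exact (mul_eq_zero.1 this).resolve_left hb
  refine ⟨h, fun k => ?_⟩
  fin_cases k <;> assumption

end HomogeneousCoordinates

namespace IncidenceSystem

open scoped LinearAlgebra.Projectivization in
-- This supplies the joining hypothesis of `Isomorphic.exists_eq_map`, since the given isomorphisms
-- are only assumed to preserve incidence.
theorem exists_mem_fieldPlane_join {F : Type*} [Field F] {l : Set (ℙ F (Fin 3 → F))}
    (hl : l ∈ (fieldPlane F).lines) (p : ℙ F (Fin 3 → F)) :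
    ∃ q ∈ l, ∃ m ∈ (fieldPlane F).lines, p ∈ m ∧ q ∈ m := by
  obtain ⟨W, hW, rfl⟩ := hl
  by_cases hp : p.submodule ≤ W
  · exact ⟨p, hp, _, ⟨W, hW, rfl⟩, hp, hp⟩
  have : Nontrivial W := Module.nontrivial_of_finrank_pos (R := F) (by omega)
  obtain ⟨⟨w, hwW⟩, hw⟩ := exists_ne (0 : W)
  have hw₀ : w ≠ 0 := by simpa using hw
  have hpW : p.rep ∉ W := by simpa [Projectivization.submodule_eq] using hp
  have hli : LinearIndependent F ![w, p.rep] := by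
    rw [LinearIndependent.pair_iff' hw₀]
    intro a ha
    exact hpW (ha ▸ W.smul_mem a hwW)
  refine ⟨Projectivization.mk F w hw₀, ?_, _,
    ⟨Submodule.span F {w, p.rep}, finrank_span_pair_eq_two hli, rfl⟩, ?_, ?_⟩
  · simpa [Projectivization.submodule_mk] using hwW
  · simpa [Projectivization.submodule_eq] using Submodule.subset_span (by simp)
  · simpa [Projectivization.submodule_mk] using Submodule.subset_span (by simp)

theorem IsFieldPlane.pappian {P L : Type*} [Membership P L] [ProjectivePlane P L]
    (h : IsFieldPlane (ofConfiguration P L)) : Pappian P L := by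
  obtain ⟨F, _, hF⟩ := h
  obtain ⟨φ, hφ, heq⟩ := hF.exists_eq_map rfl (fun l hl p => exists_mem_fieldPlane_join hl p)
    (isPartialLinear_ofConfiguration P L)
  have hsurj : Function.Surjective φ := by
    intro p
    have hp : p ∈ (ofConfiguration P L).points := Set.mem_univ p
    rw [heq] at hp
    obtain ⟨q, -, hq⟩ := hp
    exact ⟨q, hq⟩
  let e := Equiv.ofBijective φ ⟨hφ, hsurj⟩
  have hline : ∀ l : L, ∃ w : Fin 3 → F, w ≠ 0 ∧ ∀ p, p ∈ l ↔ (e.symm p).rep ⬝ᵥ w = 0 := by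
    intro l
    have hl : {p | p ∈ l} ∈ (ofConfiguration P L).lines := ⟨l, rfl⟩
    rw [heq] at hl
    obtain ⟨_, ⟨W, hW, rfl⟩, hl⟩ := hl
    obtain ⟨w, hw, rfl⟩ := exists_eq_orthogonalTo hW
    refine ⟨w, hw, fun p => ?_⟩
    change p ∈ {p | p ∈ l} ↔ _
    rw [← hl, ← mem_orthogonalTo]
    change p ∈ e '' _ ↔ _
    rw [Equiv.image_eq_preimage_symm, Set.mem_preimage, Set.mem_ofPred_eq,
      Projectivization.submodule_eq, Submodule.span_singleton_le_iff_mem]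
  choose g hg₀ hg using hline
  refine HomogeneousCoordinates.pappian
    ⟨fun p => (e.symm p).rep, g, fun p => (e.symm p).rep_nonzero, hg₀, fun p l => hg l p, ?_⟩
  intro w hw
  obtain ⟨a, ha⟩ := Projectivization.exists_smul_eq_mk_rep F w hw
  refine ⟨e (Projectivization.mk F w hw), (a⁻¹ : Fˣ), ?_⟩
  rw [Equiv.symm_apply_apply, ← ha]
  simp [Units.smul_def, smul_smul]

theorem isFieldPlane_iff_pappian {P L : Type*} [Membership P L] [ProjectivePlane P L] [Finite P]
    [Finite L] : IsFieldPlane (ofConfiguration P L) ↔ Pappian P L := by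
  refine ⟨IsFieldPlane.pappian, fun h => ?_⟩
  obtain ⟨F, _, ⟨H⟩⟩ := h.exists_homogeneousCoordinates
  exact ⟨F, inferInstance, H.isomorphic_fieldPlane⟩

end IncidenceSystem

/-! ### The Pappus configuration inside the affine plane of order 3 -/

namespace IncidenceSystem

/-- The third point of the affine line through `u` and `v`. -/
def thirdPoint (u v : Fin 3 × Fin 3) : Fin 3 × Fin 3 := -(u + v)

theorem thirdPoint_comm (u v : Fin 3 × Fin 3) : thirdPoint u v = thirdPoint v u := by
  rw [thirdPoint, thirdPoint, add_comm]

theorem thirdPoint_thirdPoint (u v : Fin 3 × Fin 3) : thirdPoint u (thirdPoint u v) = v := by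
  simp [thirdPoint]

theorem snd_thirdPoint_ne {u v : Fin 3 × Fin 3} (h : u.2 ≠ v.2) : u.2 ≠ (thirdPoint u v).2 := by
  have : ∀ x y : Fin 3, x ≠ y → x ≠ -(x + y) := by decide
  exact this _ _ h

theorem mem_pappus_lines {s : Set (Fin 3 × Fin 3)} : s ∈ pappus.lines ↔
    (∃ r : Fin 3, s = {u | u.1 = r}) ∨
      ∃ i j k : Fin 3, i ≠ j ∧ i ≠ k ∧ j ≠ k ∧ s = {(0, i), (1, j), (2, k)} := by
  have row : ∀ r : Fin 3, ({(r, 0), (r, 1), (r, 2)} : Set (Fin 3 × Fin 3)) = {u | u.1 = r} := by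
    intro r
    ext ⟨a, b⟩
    simp only [Set.mem_insert_iff, Set.mem_singleton_iff, Set.mem_ofPred_eq, Prod.mk.injEq]
    revert a b r
    decide
  constructor
  · rintro (h | h | h | h | h | h | h | h | h)
    · exact Or.inl ⟨0, h.trans (row 0)⟩
    · exact Or.inl ⟨1, h.trans (row 1)⟩
    · exact Or.inl ⟨2, h.trans (row 2)⟩
    · exact Or.inr ⟨0, 1, 2, by decide, by decide, by decide, h⟩
    · exact Or.inr ⟨1, 2, 0, by decide, by decide, by decide, h⟩
    · exact Or.inr ⟨2, 0, 1, by decide, by decide, by decide, h⟩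
    · exact Or.inr ⟨0, 2, 1, by decide, by decide, by decide, h⟩
    · exact Or.inr ⟨1, 0, 2, by decide, by decide, by decide, h⟩
    · exact Or.inr ⟨2, 1, 0, by decide, by decide, by decide, h⟩
  · rintro (⟨r, rfl⟩ | ⟨i, j, k, hij, hik, hjk, rfl⟩)
    · rw [← row r]
      fin_cases r <;> simp [pappus]
    · fin_cases i <;> fin_cases j <;> fin_cases k <;> simp at hij hik hjk <;> simp [pappus]

/-- Three points of the affine plane over `Fin 3` are collinear when they sum to zero. The
configuration is this plane with one parallel class removed, the one where the second coordinate is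
constant. -/
theorem mem_pappus_lines_iff_thirdPoint {s : Set (Fin 3 × Fin 3)} :
    s ∈ pappus.lines ↔ ∃ u v : Fin 3 × Fin 3, u.2 ≠ v.2 ∧ s = {u, v, thirdPoint u v} := by
  rw [mem_pappus_lines]
  constructor
  · rintro (⟨r, rfl⟩ | ⟨i, j, k, hij, hik, hjk, rfl⟩)
    · refine ⟨(r, 0), (r, 1), by simp, ?_⟩
      ext ⟨a, b⟩
      simp only [Set.mem_insert_iff, Set.mem_singleton_iff, Set.mem_ofPred_eq]
      revert a b r
      decide
    · refine ⟨(0, i), (1, j), hij, ?_⟩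
      have : ∀ i j k : Fin 3, i ≠ j → i ≠ k → j ≠ k →
          ((2, k) : Fin 3 × Fin 3) = thirdPoint (0, i) (1, j) := by decide
      rw [this i j k hij hik hjk]
  · rintro ⟨u, v, huv, rfl⟩
    by_cases h : u.1 = v.1
    · refine Or.inl ⟨u.1, ?_⟩
      ext w
      simp only [Set.mem_insert_iff, Set.mem_singleton_iff, Set.mem_ofPred_eq]
      revert u v w
      decide
    · right
      have key : ∀ u v : Fin 3 × Fin 3, u.2 ≠ v.2 → u.1 ≠ v.1 →
          ∃ i j k : Fin 3, i ≠ j ∧ i ≠ k ∧ j ≠ k ∧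
            ({u, v, thirdPoint u v} : Finset (Fin 3 × Fin 3)) = {(0, i), (1, j), (2, k)} := by
        decide
      obtain ⟨i, j, k, hij, hik, hjk, hw⟩ := key u v huv h
      exact ⟨i, j, k, hij, hik, hjk, by simpa using congr_arg (fun s : Finset (Fin 3 × Fin 3) => (s : Set (Fin 3 × Fin 3))) hw⟩

/-- A line of the Pappus configuration is recovered from any two of its points. -/
theorem eq_of_mem_pappus_lines {s : Set (Fin 3 × Fin 3)} (hs : s ∈ pappus.lines)
    {u v : Fin 3 × Fin 3} (hu : u ∈ s) (hv : v ∈ s) (huv : u ≠ v) :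
    u.2 ≠ v.2 ∧ s = {u, v, thirdPoint u v} := by
  obtain ⟨a, b, hab, rfl⟩ := mem_pappus_lines_iff_thirdPoint.1 hs
  have hac := snd_thirdPoint_ne hab
  have hbc := snd_thirdPoint_ne hab.symm
  rw [thirdPoint_comm] at hbc
  have h₁ := thirdPoint_thirdPoint a b
  have h₂ := thirdPoint_thirdPoint b a
  rw [thirdPoint_comm b a] at h₂
  rcases hu with rfl | rfl | rfl <;> rcases hv with rfl | rfl | rfl
  · exact absurd rfl huv
  · exact ⟨hab, rfl⟩
  · exact ⟨hac, by rw [h₁, Set.pair_comm]⟩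
  · exact ⟨hab.symm, by rw [thirdPoint_comm u v, Set.insert_comm]⟩
  · exact absurd rfl huv
  · exact ⟨hbc, by rw [h₂]; ext; simp; tauto⟩
  · exact ⟨hac.symm, by rw [thirdPoint_comm (thirdPoint _ _), h₁]; ext; simp; tauto⟩
  · exact ⟨hbc.symm, by rw [thirdPoint_comm (thirdPoint _ _), h₂]; ext; simp; tauto⟩
  · exact absurd rfl huv

theorem exists_pappus_line_join {s : Set (Fin 3 × Fin 3)} (hs : s ∈ pappus.lines)
    (p : Fin 3 × Fin 3) : ∃ q ∈ s, ∃ t ∈ pappus.lines, p ∈ t ∧ q ∈ t := by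
  obtain ⟨u, v, huv, rfl⟩ := mem_pappus_lines_iff_thirdPoint.1 hs
  by_cases h : p.2 = u.2
  · exact ⟨v, by simp, {p, v, thirdPoint p v},
      mem_pappus_lines_iff_thirdPoint.2 ⟨p, v, h ▸ huv, rfl⟩, by simp, by simp⟩
  · exact ⟨u, by simp, {p, u, thirdPoint p u},
      mem_pappus_lines_iff_thirdPoint.2 ⟨p, u, h, rfl⟩, by simp, by simp⟩

theorem map_injective {α β : Type*} {f : α → β} (hf : Function.Injective f) :
    Function.Injective (map f) := by
  intro X Y h
  rw [IncidenceSystem.ext_iff] at h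
  exact IncidenceSystem.ext (hf.image_injective h.1) (hf.image_injective.image_injective h.2)

theorem map_comp {α β γ : Type*} (g : β → γ) (f : α → β) (X : IncidenceSystem α) :
    X.map (g ∘ f) = (X.map f).map g := by
  refine IncidenceSystem.ext (Set.image_comp g f _) ?_
  simp only [map, Set.image_image, Function.comp_def]

/-- The automorphisms of the Pappus configuration. -/
def pappusAut : Set (Fin 3 × Fin 3 → Fin 3 × Fin 3) :=
  {σ | Function.Injective σ ∧ pappus.map σ = pappus}

theorem mem_lines_of_mem_pappusAut {σ : Fin 3 × Fin 3 → Fin 3 × Fin 3} (hσ : σ ∈ pappusAut)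
    {s : Set (Fin 3 × Fin 3)} : σ '' s ∈ pappus.lines ↔ s ∈ pappus.lines := by
  have h : σ '' s ∈ (pappus.map σ).lines ↔ s ∈ pappus.lines :=
    hσ.1.image_injective.mem_set_image
  rwa [hσ.2] at h

theorem snd_ne_of_mem_pappusAut {σ : Fin 3 × Fin 3 → Fin 3 × Fin 3} (hσ : σ ∈ pappusAut)
    {u v : Fin 3 × Fin 3} (huv : u.2 ≠ v.2) :
    (σ u).2 ≠ (σ v).2 ∧ σ (thirdPoint u v) = thirdPoint (σ u) (σ v) := by
  have hs := (mem_lines_of_mem_pappusAut hσ).2 (mem_pappus_lines_iff_thirdPoint.2 ⟨u, v, huv, rfl⟩)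
  have hne : u ≠ v := fun h => huv (h ▸ rfl)
  obtain ⟨h, h'⟩ := eq_of_mem_pappus_lines hs (u := σ u) (v := σ v) ⟨u, by simp, rfl⟩
    ⟨v, by simp, rfl⟩ (hσ.1.ne hne)
  refine ⟨h, ?_⟩
  have hmem : σ (thirdPoint u v) ∈ ({σ u, σ v, thirdPoint (σ u) (σ v)} : Set _) := by
    rw [← h']
    exact ⟨_, by simp, rfl⟩
  have h₁ : thirdPoint u v ≠ u := fun h => snd_thirdPoint_ne huv (by rw [h])
  have h₂ : thirdPoint u v ≠ v := fun h => snd_thirdPoint_ne huv.symm (by rw [thirdPoint_comm, h])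
  exact (hmem.resolve_left (hσ.1.ne h₁)).resolve_left (hσ.1.ne h₂)

/-- Equal second coordinates mean not joined by a line. A line joining the images would be the image
of a line joining the points. -/
theorem snd_eq_of_mem_pappusAut {σ : Fin 3 × Fin 3 → Fin 3 × Fin 3} (hσ : σ ∈ pappusAut)
    {u v : Fin 3 × Fin 3} (huv : u.2 = v.2) (hne : u ≠ v) : (σ u).2 = (σ v).2 := by
  by_contra h
  have hs : ({σ u, σ v, thirdPoint (σ u) (σ v)} : Set _) ∈ pappus.lines :=
    mem_pappus_lines_iff_thirdPoint.2 ⟨_, _, h, rfl⟩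
  rw [← hσ.2] at hs
  obtain ⟨t, ht, hts⟩ := hs
  have hmem : ∀ w, σ w ∈ ({σ u, σ v, thirdPoint (σ u) (σ v)} : Set _) → w ∈ t := fun w hw => by
    rw [← hts] at hw
    exact hσ.1.mem_set_image.1 hw
  exact (eq_of_mem_pappus_lines ht (hmem u (by simp)) (hmem v (by simp)) hne).1 huv

/-- The affine map of `(Fin 3)²` with prescribed values at `(0, 0)`, `(0, 1)` and `(1, 0)`. -/
def affineMap (p q r u : Fin 3 × Fin 3) : Fin 3 × Fin 3 :=
  (p.1 + u.1 * (r.1 - p.1) + u.2 * (q.1 - p.1), p.2 + u.1 * (r.2 - p.2) + u.2 * (q.2 - p.2))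

/-- Because `p.2 = r.2`, the new second coordinate depends only on the old one, and injectively; the
removed parallel class is respected. Injectivity on a finite configuration then upgrades inclusion
of the line sets to equality. -/
theorem affineMap_mem_pappusAut {p q r : Fin 3 × Fin 3} (hpq : p.2 ≠ q.2) (hpr : p.2 = r.2)
    (hne : p.1 ≠ r.1) : affineMap p q r ∈ pappusAut := by
  have snd_ne : ∀ u v : Fin 3 × Fin 3, u.2 ≠ v.2 → (affineMap p q r u).2 ≠ (affineMap p q r v).2 := by
    have : ∀ x y a b i j : Fin 3, x ≠ y → i ≠ j →
        x + a * (x - x) + i * (y - x) ≠ x + b * (x - x) + j * (y - x) := by decide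
    intro u v huv
    simp only [affineMap, ← hpr]
    exact this _ _ _ _ _ _ hpq huv
  have third : ∀ u v : Fin 3 × Fin 3, affineMap p q r (thirdPoint u v) =
      thirdPoint (affineMap p q r u) (affineMap p q r v) := by
    have : ∀ x y z a b i j : Fin 3, x + -(a + b) * (z - x) + -(i + j) * (y - x) =
        -(x + a * (z - x) + i * (y - x) + (x + b * (z - x) + j * (y - x))) := by decide
    intro u v
    exact Prod.ext (this _ _ _ _ _ _ _) (this _ _ _ _ _ _ _)
  have inj : Function.Injective (affineMap p q r) := by
    intro u v h
    have h₂ : u.2 = v.2 := by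
      by_contra h'
      exact snd_ne u v h' (by rw [h])
    have : ∀ x z a b c : Fin 3, x ≠ z → x + a * (z - x) + c = x + b * (z - x) + c → a = b := by
      decide
    have h₁ := congr_arg Prod.fst h
    simp only [affineMap, h₂] at h₁
    exact Prod.ext (this _ _ _ _ _ hne h₁) h₂
  refine ⟨inj, IncidenceSystem.ext ?_ ?_⟩
  · exact (Set.image_univ).trans (Finite.injective_iff_surjective.1 inj).range_eq
  · refine Set.eq_of_subset_of_ncard_le ?_ ?_ (Set.toFinite _)
    · rintro _ ⟨s, hs, rfl⟩
      obtain ⟨u, v, huv, rfl⟩ := mem_pappus_lines_iff_thirdPoint.1 hs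
      refine mem_pappus_lines_iff_thirdPoint.2
        ⟨affineMap p q r u, affineMap p q r v, snd_ne u v huv, ?_⟩
      simp only [Set.image_insert_eq, Set.image_singleton, third]
    · exact (Set.ncard_image_of_injective _ inj.image_injective).ge

/-- An automorphism is determined by the images of (0, 0), (0, 1), (1, 0), since the other points
arise as successive third points. There are 9 choices for the first image, 6 for the second (another
class) and 2 for the third (same class), all realized by affine maps. -/
theorem card_pappusAut : Nat.card pappusAut = 108 := by
  let T : Finset ((Fin 3 × Fin 3) × (Fin 3 × Fin 3) × (Fin 3 × Fin 3)) :=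
    Finset.univ.filter fun t => t.1.2 ≠ t.2.1.2 ∧ t.1.2 = t.2.2.2 ∧ t.1.1 ≠ t.2.2.1
  have hT : T.card = 108 := by decide +kernel
  have hmem : ∀ σ : pappusAut, (σ.1 (0, 0), σ.1 (0, 1), σ.1 (1, 0)) ∈ T := by
    rintro ⟨σ, hσ⟩
    have h₂ := snd_eq_of_mem_pappusAut hσ (u := (0, 0)) (v := (1, 0)) rfl (by decide)
    refine Finset.mem_filter.2 ⟨Finset.mem_univ _,
      (snd_ne_of_mem_pappusAut hσ (u := (0, 0)) (v := (0, 1)) (by decide)).1, h₂, fun h₁ => ?_⟩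
    exact absurd (hσ.1 (Prod.ext h₁ h₂)) (by decide)
  let Φ : pappusAut → T := fun σ => ⟨(σ.1 (0, 0), σ.1 (0, 1), σ.1 (1, 0)), hmem σ⟩
  have hΦ : Function.Bijective Φ := by
    constructor
    · rintro ⟨σ, hσ⟩ ⟨τ, hτ⟩ h
      simp only [Φ, Subtype.mk.injEq, Prod.mk.injEq] at h
      obtain ⟨h₀₀, h₀₁, h₁₀⟩ := h
      have step : ∀ u v w : Fin 3 × Fin 3, u.2 ≠ v.2 → thirdPoint u v = w → σ u = τ u →
          σ v = τ v → σ w = τ w := by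
        rintro u v _ huv rfl hu hv
        rw [(snd_ne_of_mem_pappusAut hσ huv).2, (snd_ne_of_mem_pappusAut hτ huv).2, hu, hv]
      have h₀₂ := step (0, 0) (0, 1) (0, 2) (by decide) (by decide) h₀₀ h₀₁
      have h₂₂ := step (1, 0) (0, 1) (2, 2) (by decide) (by decide) h₁₀ h₀₁
      have h₂₁ := step (1, 0) (0, 2) (2, 1) (by decide) (by decide) h₁₀ h₀₂
      have h₂₀ := step (2, 2) (2, 1) (2, 0) (by decide) (by decide) h₂₂ h₂₁
      have h₁₂ := step (0, 1) (2, 0) (1, 2) (by decide) (by decide) h₀₁ h₂₀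
      have h₁₁ := step (0, 2) (2, 0) (1, 1) (by decide) (by decide) h₀₂ h₂₀
      refine Subtype.ext (funext fun u => ?_)
      obtain ⟨a, b⟩ := u
      fin_cases a <;> fin_cases b <;> assumption
    · rintro ⟨⟨p, q, r⟩, ht⟩
      obtain ⟨-, hpq, hpr, hne⟩ := Finset.mem_filter.1 ht
      refine ⟨⟨affineMap p q r, affineMap_mem_pappusAut hpq hpr hne⟩, Subtype.ext ?_⟩
      simp [Φ, affineMap]
  rw [← hT, Nat.card_eq_of_bijective Φ hΦ, Nat.card_eq_fintype_card, Fintype.card_coe]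

end IncidenceSystem

/-! ### Labelled copies of the configuration in a plane -/

namespace IncidenceSystem

variable {P L : Type*} [Membership P L]

variable (L) in
/-- A labelling of nine points by the points of the Pappus configuration whose nine lines are
induced by lines of the plane. -/
def IsPappusEmbedding (φ : Fin 3 × Fin 3 → P) : Prop :=
  Function.Injective φ ∧ ∀ s ∈ pappus.lines, ∃ l : L, ∀ u, φ u ∈ l ↔ u ∈ s

/-- A subsystem inherits partial linearity from the plane, so an isomorphism onto it is an injective
image. Its lines being traces of plane lines is what makes incidence an equivalence in
`IsPappusEmbedding`. -/
theorem setOf_isSubsystem_pappus [ProjectivePlane P L] :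
    {Z : IncidenceSystem P | IsSubsystem Z (ofConfiguration P L) ∧ Isomorphic pappus Z} =
      (fun φ => pappus.map φ) '' {φ | IsPappusEmbedding L φ} := by
  ext Z
  constructor
  · rintro ⟨⟨-, hsub⟩, hiso⟩
    have hZ : Z.IsPartialLinear := by
      intro l' hl' m' hm' p hpl q hql hpm hqm hpq
      obtain ⟨l, hl, rfl⟩ := hsub l' hl'
      obtain ⟨m, hm, rfl⟩ := hsub m' hm'
      rw [isPartialLinear_ofConfiguration P L l hl m hm p hpl.1 q hql.1 hpm.1 hqm.1 hpq]
    obtain ⟨φ, hφ, rfl⟩ := hiso.exists_eq_map rfl (fun l hl p => exists_pappus_line_join hl p) hZ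
    refine ⟨φ, ⟨hφ, fun s hs => ?_⟩, rfl⟩
    obtain ⟨_, ⟨l, rfl⟩, h⟩ := hsub (φ '' s) ⟨s, hs, rfl⟩
    refine ⟨l, fun u => ?_⟩
    rw [← hφ.mem_set_image (s := s), h]
    exact ⟨fun hu => ⟨hu, u, Set.mem_univ u, rfl⟩, fun hu => hu.1⟩
  · rintro ⟨φ, ⟨hφ, hlines⟩, rfl⟩
    refine ⟨⟨Set.subset_univ _, ?_⟩, isomorphic_map hφ _⟩
    rintro _ ⟨s, hs, rfl⟩
    obtain ⟨l, hl⟩ := hlines s hs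
    refine ⟨_, ⟨l, rfl⟩, ?_⟩
    ext p
    constructor
    · rintro ⟨u, hu, rfl⟩
      exact ⟨(hl u).2 hu, u, Set.mem_univ u, rfl⟩
    · rintro ⟨hp, u, -, rfl⟩
      exact ⟨u, (hl u).1 hp, rfl⟩

/-- Every subsystem isomorphic to the Pappus configuration has 108 labellings. -/
theorem card_isPappusEmbedding [ProjectivePlane P L] :
    Nat.card {φ : Fin 3 × Fin 3 → P | IsPappusEmbedding L φ} =
      inclusionNumber pappus (ofConfiguration P L) * 108 := by
  rw [inclusionNumber, setOf_isSubsystem_pappus, ← Nat.card_coe_set_eq, ← card_pappusAut,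
    ← Nat.card_prod]
  -- One labelling is fixed per subsystem; every other labelling of it is that one preceded by a
  -- unique automorphism.
  have hrep : ∀ Z : (fun φ => pappus.map φ) '' {φ | IsPappusEmbedding L φ},
      ∃ φ, IsPappusEmbedding L φ ∧ pappus.map φ = Z := fun Z => Z.2
  choose rep hrep hmap using hrep
  let Ψ : (fun φ => pappus.map φ) '' {φ | IsPappusEmbedding L φ} × pappusAut →
      {φ : Fin 3 × Fin 3 → P | IsPappusEmbedding L φ} := fun t =>
    ⟨rep t.1 ∘ t.2.1, (hrep t.1).1.comp t.2.2.1, fun s hs => by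
      obtain ⟨l, hl⟩ := (hrep t.1).2 _ ((mem_lines_of_mem_pappusAut t.2.2).2 hs)
      exact ⟨l, fun u => (hl _).trans t.2.2.1.mem_set_image⟩⟩
  refine (Nat.card_eq_of_bijective Ψ ⟨?_, ?_⟩).symm
  · rintro ⟨Z, σ⟩ ⟨Z', σ'⟩ h
    have h' : rep Z ∘ σ.1 = rep Z' ∘ σ'.1 := congr_arg Subtype.val h
    have hZ : Z = Z' := by
      have := congr_arg (fun φ => pappus.map φ) h'
      simp only [map_comp, σ.2.2, σ'.2.2, hmap] at this
      exact Subtype.ext this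
    subst hZ
    have hσ : σ = σ' := Subtype.ext ((hrep Z).1.comp_left h')
    rw [hσ]
  · rintro ⟨φ, hφ⟩
    let Z : (fun φ => pappus.map φ) '' {φ | IsPappusEmbedding L φ} := ⟨_, φ, hφ, rfl⟩
    have hZ : pappus.map (rep Z) = pappus.map φ := hmap Z
    have hmem : ∀ u, ∃ v, rep Z v = φ u := by
      intro u
      have hu : φ u ∈ (pappus.map φ).points := ⟨u, Set.mem_univ u, rfl⟩
      rw [← hZ] at hu
      obtain ⟨v, -, hv⟩ := hu
      exact ⟨v, hv⟩
    choose σ hσ using hmem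
    have hcomp : rep Z ∘ σ = φ := funext hσ
    have hinj : Function.Injective σ := by
      apply Function.Injective.of_comp (f := rep Z)
      rw [hcomp]
      exact hφ.1
    refine ⟨(Z, ⟨σ, hinj, ?_⟩), Subtype.ext hcomp⟩
    apply map_injective (hrep Z).1
    rw [← map_comp, hcomp, hZ]

end IncidenceSystem

open IncidenceSystem

/-! ### Hexagons and their number -/

section Hexagon

variable {P L : Type*} [Membership P L]

/-- The points `φ (0, i)` of `l` and `φ (1, i)` of `m` form a hexagon with cross joins
`φ (2, i)`. -/
structure IsHexagon (l m : L) (φ : Fin 3 × Fin 3 → P) : Prop where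
  injective_zero : Function.Injective fun i => φ (0, i)
  injective_one : Function.Injective fun i => φ (1, i)
  mem_zero : ∀ i, φ (0, i) ∈ l ∧ φ (0, i) ∉ m
  mem_one : ∀ i, φ (1, i) ∈ m ∧ φ (1, i) ∉ l
  cross : ∀ i j k, i ≠ j → i ≠ k → j ≠ k →
    ∃ a : L, φ (0, i) ∈ a ∧ φ (1, j) ∈ a ∧ φ (2, k) ∈ a

theorem pappian_iff_forall_isHexagon :
    Pappian P L ↔ ∀ (l m : L) (φ : Fin 3 × Fin 3 → P), IsHexagon l m φ →
      ∃ h : L, ∀ k, φ (2, k) ∈ h := by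
  constructor
  · intro hP l m φ hφ
    exact hP l m (fun i => φ (0, i)) (fun i => φ (1, i)) (fun i => φ (2, i)) hφ.1 hφ.2 hφ.3 hφ.4
      hφ.5
  · intro h l m x y z hx hy hxl hym hz
    exact h l m (fun u => ![x u.2, y u.2, z u.2] u.1) ⟨hx, hy, hxl, hym, hz⟩

theorem Fin.exists_others (k : Fin 3) : ∃ i j : Fin 3, i ≠ j ∧ i ≠ k ∧ j ≠ k := by
  revert k
  decide

theorem Fin.exists_other (j k : Fin 3) (h : j ≠ k) : ∃ i : Fin 3, i ≠ j ∧ i ≠ k := by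
  revert j k
  decide

variable [ProjectivePlane P L]

namespace IsHexagon

variable {l m : L} {φ : Fin 3 × Fin 3 → P}

theorem ne_cross (hφ : IsHexagon l m φ) {i j i' j' : Fin 3} {a a' : L} (h : i ≠ i')
    (ha : φ (0, i) ∈ a ∧ φ (1, j) ∈ a) (ha' : φ (0, i') ∈ a' ∧ φ (1, j') ∈ a') : a ≠ a' := by
  rintro rfl
  have := line_eq_of_mem (hφ.injective_zero.ne h) ha.1 ha'.1 (hφ.mem_zero i).1 (hφ.mem_zero i').1
  exact (hφ.mem_one j).2 (this ▸ ha.2)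

theorem ne_cross' (hφ : IsHexagon l m φ) {i j i' j' : Fin 3} {a a' : L} (h : j ≠ j')
    (ha : φ (0, i) ∈ a ∧ φ (1, j) ∈ a) (ha' : φ (0, i') ∈ a' ∧ φ (1, j') ∈ a') : a ≠ a' := by
  rintro rfl
  have := line_eq_of_mem (hφ.injective_one.ne h) ha.2 ha'.2 (hφ.mem_one j).1 (hφ.mem_one j').1
  exact (hφ.mem_zero i).2 (this ▸ ha.1)

/-- The two sides through the cross join meet `l` only in their vertices `φ (0, i)` and `φ (0, j)`;
a cross join on `l` would equal both. -/
theorem two_notMem_left (hφ : IsHexagon l m φ) (k : Fin 3) : φ (2, k) ∉ l := by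
  intro hk
  obtain ⟨i, j, hij, hik, hjk⟩ := Fin.exists_others k
  have key : ∀ i j, i ≠ j → i ≠ k → j ≠ k → φ (2, k) = φ (0, i) := by
    intro i j hij hik hjk
    obtain ⟨a, hxa, hya, hza⟩ := hφ.cross i j k hij hik hjk
    refine point_eq_of_mem ?_ hza hk hxa (hφ.mem_zero i).1
    rintro rfl
    exact (hφ.mem_one j).2 hya
  exact hij (hφ.injective_zero ((key i j hij hik hjk).symm.trans (key j i hij.symm hjk hik)))

theorem two_notMem_right (hφ : IsHexagon l m φ) (k : Fin 3) : φ (2, k) ∉ m := by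
  intro hk
  obtain ⟨i, j, hij, hik, hjk⟩ := Fin.exists_others k
  have key : ∀ i j, i ≠ j → i ≠ k → j ≠ k → φ (2, k) = φ (1, j) := by
    intro i j hij hik hjk
    obtain ⟨a, hxa, hya, hza⟩ := hφ.cross i j k hij hik hjk
    refine point_eq_of_mem ?_ hza hk hya (hφ.mem_one j).1
    rintro rfl
    exact (hφ.mem_zero i).2 hxa
  exact hij (hφ.injective_one ((key j i hij.symm hjk hik).symm.trans (key i j hij hik hjk)))

theorem zero_ne_two (hφ : IsHexagon l m φ) (i k : Fin 3) : φ (0, i) ≠ φ (2, k) := fun h =>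
  hφ.two_notMem_left k (h ▸ (hφ.mem_zero i).1)

theorem one_ne_two (hφ : IsHexagon l m φ) (i k : Fin 3) : φ (1, i) ≠ φ (2, k) := fun h =>
  hφ.two_notMem_right k (h ▸ (hφ.mem_one i).1)

theorem injective_two (hφ : IsHexagon l m φ) : Function.Injective fun k => φ (2, k) := by
  intro k j (h : φ (2, k) = φ (2, j))
  by_contra hkj
  obtain ⟨i, hik, hij⟩ := Fin.exists_other k j hkj
  obtain ⟨a, ha⟩ := hφ.cross i j k hij hik (Ne.symm hkj)
  obtain ⟨b, hb⟩ := hφ.cross i k j hik hij hkj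
  exact hφ.zero_ne_two i k (point_eq_of_mem
    (hφ.ne_cross' (Ne.symm hkj) ⟨ha.1, ha.2.1⟩ ⟨hb.1, hb.2.1⟩) ha.1 hb.1 ha.2.2 (h ▸ hb.2.2))

theorem injective (hφ : IsHexagon l m φ) : Function.Injective φ := by
  have h₀₁ : ∀ i j, φ (0, i) ≠ φ (1, j) := fun i j h => (hφ.mem_one j).2 (h ▸ (hφ.mem_zero i).1)
  rintro ⟨r, i⟩ ⟨s, j⟩ h
  fin_cases r <;> fin_cases s
  · exact congr_arg _ (hφ.injective_zero h)
  · exact absurd h (h₀₁ i j)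
  · exact absurd h (hφ.zero_ne_two i j)
  · exact absurd h.symm (h₀₁ j i)
  · exact congr_arg _ (hφ.injective_one h)
  · exact absurd h (hφ.one_ne_two i j)
  · exact absurd h.symm (hφ.zero_ne_two j i)
  · exact absurd h.symm (hφ.one_ne_two j i)
  · exact congr_arg _ (hφ.injective_two h)

/-- An extra incidence would make two different sides of the hexagon coincide. In particular a
vertex on `h` would make both sides through it equal to `h`. -/
theorem isPappusEmbedding (hφ : IsHexagon l m φ) {h : L} (hh : ∀ k, φ (2, k) ∈ h) :
    IsPappusEmbedding L φ := by
  refine ⟨hφ.injective, fun s hs => ?_⟩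
  rcases mem_pappus_lines.1 hs with ⟨r, rfl⟩ | ⟨i, j, k, hij, hik, hjk, rfl⟩
  · have key : ∀ i j k, i ≠ j → i ≠ k → j ≠ k → φ (0, i) ∉ h ∧ φ (1, i) ∉ h := by
      intro i j k hij hik hjk
      constructor
      · intro hi
        obtain ⟨a, ha⟩ := hφ.cross i j k hij hik hjk
        obtain ⟨b, hb⟩ := hφ.cross i k j hik hij hjk.symm
        refine hφ.ne_cross' hjk ⟨ha.1, ha.2.1⟩ ⟨hb.1, hb.2.1⟩ ?_
        rw [line_eq_of_mem (hφ.zero_ne_two i k) ha.1 ha.2.2 hi (hh k),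
          line_eq_of_mem (hφ.zero_ne_two i j) hb.1 hb.2.2 hi (hh j)]
      · intro hi
        obtain ⟨a, ha⟩ := hφ.cross j i k hij.symm hjk hik
        obtain ⟨b, hb⟩ := hφ.cross k i j hik.symm hjk.symm hij
        refine hφ.ne_cross hjk ⟨ha.1, ha.2.1⟩ ⟨hb.1, hb.2.1⟩ ?_
        rw [line_eq_of_mem (hφ.one_ne_two i k) ha.2.1 ha.2.2 hi (hh k),
          line_eq_of_mem (hφ.one_ne_two i j) hb.2.1 hb.2.2 hi (hh j)]
    have hnot : ∀ i, φ (0, i) ∉ h ∧ φ (1, i) ∉ h := fun i => by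
      obtain ⟨j, k, hjk, hji, hki⟩ := Fin.exists_others i
      exact key i j k hji.symm hki.symm hjk
    refine ⟨![l, m, h] r, ?_⟩
    rintro ⟨s, i⟩
    have h0 := hφ.mem_zero i
    have h1 := hφ.mem_one i
    have h2 := hφ.two_notMem_left i
    have h2' := hφ.two_notMem_right i
    have h3 := hnot i
    have h4 := hh i
    fin_cases r <;> fin_cases s <;> simp_all
  · obtain ⟨a, hxa, hya, hza⟩ := hφ.cross i j k hij hik hjk
    refine ⟨a, ?_⟩
    have h0 : ∀ i', φ (0, i') ∈ a ↔ i' = i := by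
      refine fun i' => ⟨fun h => ?_, fun h => h ▸ hxa⟩
      by_contra hne
      exact hφ.ne_cross hne ⟨h, hya⟩ ⟨hxa, hya⟩ rfl
    have h1 : ∀ j', φ (1, j') ∈ a ↔ j' = j := by
      refine fun j' => ⟨fun h => ?_, fun h => h ▸ hya⟩
      by_contra hne
      exact hφ.ne_cross' hne ⟨hxa, h⟩ ⟨hxa, hya⟩ rfl
    have h2 : ∀ k', φ (2, k') ∈ a ↔ k' = k := by
      refine fun k' => ⟨fun h => ?_, fun h => h ▸ hza⟩
      have hcases : ∀ i j k k' : Fin 3, i ≠ j → i ≠ k → j ≠ k → k' = k ∨ k' = i ∨ k' = j := by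
        decide
      rcases hcases i j k k' hij hik hjk with rfl | rfl | rfl
      · rfl
      · obtain ⟨b, hxb, hyb, hzb⟩ := hφ.cross k j k' hjk.symm hik.symm hij.symm
        exact absurd (line_eq_of_mem (hφ.one_ne_two j k') hya h hyb hzb)
          (hφ.ne_cross hik ⟨hxa, hya⟩ ⟨hxb, hyb⟩)
      · obtain ⟨b, hxb, hyb, hzb⟩ := hφ.cross i k k' hik hij hjk.symm
        exact absurd (line_eq_of_mem (hφ.zero_ne_two i k') hxa h hxb hzb)
          (hφ.ne_cross' hjk ⟨hxa, hya⟩ ⟨hxb, hyb⟩)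
    rintro ⟨s, i'⟩
    fin_cases s <;> simp [h0, h1, h2]

theorem ext {ψ : Fin 3 × Fin 3 → P} (hφ : IsHexagon l m φ) (hψ : IsHexagon l m ψ)
    (h₀ : ∀ i, φ (0, i) = ψ (0, i)) (h₁ : ∀ i, φ (1, i) = ψ (1, i)) : φ = ψ := by
  have h₂ : ∀ k, φ (2, k) = ψ (2, k) := by
    intro k
    obtain ⟨i, j, hij, hik, hjk⟩ := Fin.exists_others k
    have h₀₁ : ∀ i j, φ (0, i) ≠ φ (1, j) := fun i j h =>
      (hφ.mem_one j).2 (h ▸ (hφ.mem_zero i).1)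
    have key : ∀ i j, i ≠ j → i ≠ k → j ≠ k →
        ∃ a : L, (φ (0, i) ∈ a ∧ φ (1, j) ∈ a) ∧ φ (2, k) ∈ a ∧ ψ (2, k) ∈ a := by
      intro i j hij hik hjk
      obtain ⟨a, hxa, hya, hza⟩ := hφ.cross i j k hij hik hjk
      obtain ⟨b, hxb, hyb, hzb⟩ := hψ.cross i j k hij hik hjk
      rw [← h₀] at hxb
      rw [← h₁] at hyb
      obtain rfl := line_eq_of_mem (h₀₁ i j) hxa hya hxb hyb
      exact ⟨a, ⟨hxa, hya⟩, hza, hzb⟩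
    obtain ⟨a, ha, hza, hza'⟩ := key i j hij hik hjk
    obtain ⟨b, hb, hzb, hzb'⟩ := key j i hij.symm hjk hik
    exact point_eq_of_mem (hφ.ne_cross hij ha hb) hza hzb hza' hzb'
  funext u
  obtain ⟨r, i⟩ := u
  fin_cases r
  exacts [h₀ i, h₁ i, h₂ i]

end IsHexagon

omit [ProjectivePlane P L] in
theorem IncidenceSystem.IsPappusEmbedding.isHexagon {φ : Fin 3 × Fin 3 → P}
    (hφ : IsPappusEmbedding L φ) :
    (∃ l m : L, IsHexagon l m φ) ∧ ∃ h : L, ∀ k, φ (2, k) ∈ h := by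
  have row : ∀ r : Fin 3, ∃ l : L, ∀ u, φ u ∈ l ↔ u.1 = r := fun r =>
    hφ.2 _ (mem_pappus_lines.2 (Or.inl ⟨r, rfl⟩))
  obtain ⟨l, hl⟩ := row 0
  obtain ⟨m, hm⟩ := row 1
  obtain ⟨h, hh⟩ := row 2
  refine ⟨⟨l, m, ?_, ?_, ?_, ?_, ?_⟩, h, fun k => (hh _).2 rfl⟩
  · exact fun i j hij => congr_arg Prod.snd (hφ.1 hij)
  · exact fun i j hij => congr_arg Prod.snd (hφ.1 hij)
  · exact fun i => ⟨(hl _).2 rfl, fun h => absurd ((hm _).1 h) (by simp)⟩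
  · exact fun i => ⟨(hm _).2 rfl, fun h => absurd ((hl _).1 h) (by simp)⟩
  · intro i j k hij hik hjk
    obtain ⟨a, ha⟩ := hφ.2 _ (mem_pappus_lines.2 (Or.inr ⟨i, j, k, hij, hik, hjk, rfl⟩))
    exact ⟨a, (ha _).2 (by simp), (ha _).2 (by simp), (ha _).2 (by simp)⟩

theorem exists_isHexagon {l m : L} {x y : Fin 3 → P} (hx : Function.Injective x)
    (hy : Function.Injective y) (hxl : ∀ i, x i ∈ l ∧ x i ∉ m) (hym : ∀ i, y i ∈ m ∧ y i ∉ l) :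
    ∃ φ, IsHexagon l m φ ∧ (∀ i, φ (0, i) = x i) ∧ ∀ i, φ (1, i) = y i := by
  have hjoin : ∀ i j, ∃ a : L, x i ∈ a ∧ y j ∈ a := fun i j => exists_line_mem_mem _ _
  choose a hxa hya using hjoin
  have hne : ∀ i j, i ≠ j → a i j ≠ a j i := by
    intro i j hij h
    have := line_eq_of_mem (hx.ne hij) (hxa i j) (h ▸ hxa j i) (hxl i).1 (hxl j).1
    exact (hym j).2 (this ▸ hya i j)
  have hz : ∀ k, ∃ z : P, ∀ i j, i ≠ j → i ≠ k → j ≠ k → z ∈ a i j := by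
    intro k
    obtain ⟨i, j, hij, hik, hjk⟩ := Fin.exists_others k
    obtain ⟨z, hz, hz'⟩ := exists_point_mem_mem (P := P) (hne i j hij)
    refine ⟨z, fun i' j' hij' hik' hjk' => ?_⟩
    have hcases : ∀ i j k i' j' : Fin 3, i ≠ j → i ≠ k → j ≠ k → i' ≠ j' → i' ≠ k → j' ≠ k →
        (i' = i ∧ j' = j) ∨ (i' = j ∧ j' = i) := by decide
    rcases hcases i j k i' j' hij hik hjk hij' hik' hjk' with ⟨rfl, rfl⟩ | ⟨rfl, rfl⟩ <;> assumption
  choose z hz using hz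
  exact ⟨fun u => ![x u.2, y u.2, z u.2] u.1, ⟨hx, hy, hxl, hym, fun i j k hij hik hjk =>
    ⟨a i j, hxa i j, hya i j, hz k i j hij hik hjk⟩⟩, fun _ => rfl, fun _ => rfl⟩

theorem card_mem_notMem [Finite P] [Finite L] {l m : L} (h : l ≠ m) :
    Nat.card {p : P // p ∈ l ∧ p ∉ m} = ProjectivePlane.order P L := by
  obtain ⟨O, hOl, hOm⟩ := exists_point_mem_mem (P := P) h
  have hl : {p : P | p ∈ l ∧ p ∉ m} = {p | p ∈ l} \ {O} := by
    ext p
    refine and_congr_right fun hp => not_congr ⟨fun hpm => ?_, fun hpO => ?_⟩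
    · exact point_eq_of_mem h hp hpm hOl hOm
    · exact hpO ▸ hOm
  have hcard : {p : P | p ∈ l}.ncard = ProjectivePlane.order P L + 1 :=
    ProjectivePlane.pointCount_eq P l
  change Nat.card {p : P | p ∈ l ∧ p ∉ m} = _
  rw [Nat.card_coe_set_eq, hl, Set.ncard_sdiff_singleton_of_mem (show O ∈ {p | p ∈ l} from hOl), hcard, Nat.add_sub_cancel]

/-- The two lines are recovered from the labelled vertices, and the cross joins are determined by
them, so hexagons correspond to ordered pairs of lines with an injective triple on each. Each line
has n points off the other. -/
theorem card_isHexagon [Finite P] [Finite L] :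
    Nat.card {φ : Fin 3 × Fin 3 → P | ∃ l m : L, IsHexagon l m φ} =
      (Nat.card L * (Nat.card L - 1)) * ((ProjectivePlane.order P L).descFactorial 3) ^ 2 := by
  classical
  have := Fintype.ofFinite P
  have := Fintype.ofFinite L
  let S := Σ a : {a : L × L // a.1 ≠ a.2},
    (Fin 3 ↪ {p : P // p ∈ a.1.1 ∧ p ∉ a.1.2}) × (Fin 3 ↪ {p : P // p ∈ a.1.2 ∧ p ∉ a.1.1})
  have hS : ∀ t : S, ∃ φ, IsHexagon t.1.1.1 t.1.1.2 φ ∧ (∀ i, φ (0, i) = t.2.1 i) ∧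
      ∀ i, φ (1, i) = t.2.2 i := fun t =>
    exists_isHexagon (Subtype.val_injective.comp t.2.1.injective)
      (Subtype.val_injective.comp t.2.2.injective) (fun i => (t.2.1 i).2) (fun i => (t.2.2 i).2)
  choose Φ hΦ hΦ₀ hΦ₁ using hS
  have hbij : Function.Bijective fun t : S =>
      (⟨Φ t, _, _, hΦ t⟩ : {φ : Fin 3 × Fin 3 → P | ∃ l m : L, IsHexagon l m φ}) := by
    constructor
    · intro t t' h
      have h' : Φ t = Φ t' := congr_arg Subtype.val h
      have hl : t.1.1.1 = t'.1.1.1 := by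
        refine line_eq_of_mem ((hΦ t).injective_zero.ne (show (0 : Fin 3) ≠ 1 by decide))
          ((hΦ t).mem_zero 0).1 ((hΦ t).mem_zero 1).1 ?_ ?_
        all_goals rw [h']; exact ((hΦ t').mem_zero _).1
      have hm : t.1.1.2 = t'.1.1.2 := by
        refine line_eq_of_mem ((hΦ t).injective_one.ne (show (0 : Fin 3) ≠ 1 by decide))
          ((hΦ t).mem_one 0).1 ((hΦ t).mem_one 1).1 ?_ ?_
        all_goals rw [h']; exact ((hΦ t').mem_one _).1
      have h₀ : ∀ i, (t.2.1 i : P) = t'.2.1 i := fun i => by rw [← hΦ₀, ← hΦ₀, h']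
      have h₁ : ∀ i, (t.2.2 i : P) = t'.2.2 i := fun i => by rw [← hΦ₁, ← hΦ₁, h']
      clear h h'
      obtain ⟨⟨⟨l, m⟩, hlm⟩, x, y⟩ := t
      obtain ⟨⟨⟨l', m'⟩, hlm'⟩, x', y'⟩ := t'
      obtain rfl : l = l' := hl
      obtain rfl : m = m' := hm
      obtain rfl : x = x' := DFunLike.ext _ _ fun i => Subtype.ext (h₀ i)
      obtain rfl : y = y' := DFunLike.ext _ _ fun i => Subtype.ext (h₁ i)
      rfl
    · rintro ⟨φ, l, m, hφ⟩
      have hlm : l ≠ m := by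
        rintro rfl
        exact (hφ.mem_zero 0).2 (hφ.mem_zero 0).1
      let t : S := ⟨⟨(l, m), hlm⟩,
        ⟨fun i => ⟨φ (0, i), hφ.mem_zero i⟩, fun i j h =>
          hφ.injective_zero (congr_arg Subtype.val h)⟩,
        ⟨fun i => ⟨φ (1, i), hφ.mem_one i⟩, fun i j h =>
          hφ.injective_one (congr_arg Subtype.val h)⟩⟩
      exact ⟨t, Subtype.ext ((hΦ t).ext hφ (hΦ₀ t) (hΦ₁ t))⟩
  rw [← Nat.card_eq_of_bijective _ hbij, Nat.card_sigma]
  have hfiber : ∀ a : {a : L × L // a.1 ≠ a.2},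
      Nat.card ((Fin 3 ↪ {p : P // p ∈ a.1.1 ∧ p ∉ a.1.2}) ×
        (Fin 3 ↪ {p : P // p ∈ a.1.2 ∧ p ∉ a.1.1})) =
          ((ProjectivePlane.order P L).descFactorial 3) ^ 2 := by
    intro a
    have hemb : ∀ (α : Type _) [Finite α], Nat.card (Fin 3 ↪ α) = (Nat.card α).descFactorial 3 := by
      intro α _
      have := Fintype.ofFinite α
      rw [Nat.card_eq_fintype_card, Nat.card_eq_fintype_card, Fintype.card_embedding_eq,
        Fintype.card_fin]
    rw [Nat.card_prod, hemb, hemb, card_mem_notMem a.2, card_mem_notMem a.2.symm, sq]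
  rw [Finset.sum_congr rfl fun a _ => hfiber a, Finset.sum_const, smul_eq_mul, Finset.card_univ,
    Nat.card_eq_fintype_card]
  congr 1
  have hdiag : (Finset.univ : Finset L).offDiag.card = Fintype.card {a : L × L // a.1 ≠ a.2} := by
    rw [Fintype.card_subtype]
    congr 1
    ext a
    simp
  rw [← hdiag, Finset.offDiag_card, Finset.card_univ, Nat.mul_sub_one]

end Hexagon

/-! ### Comparing labelled copies with hexagons -/

theorem theorem4p4 {P L : Type*} [Membership P L] [Configuration.ProjectivePlane P L]
    [Finite P] [Finite L] (n : ℕ) (hn : Configuration.ProjectivePlane.order P L = n) :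
    (IncidenceSystem.inclusionNumber IncidenceSystem.pappus
        (IncidenceSystem.ofConfiguration P L) : ℚ)
      ≤ 2 / 3 * ((n ^ 2 + n + 1).choose 2 : ℚ) * (n.choose 3 : ℚ) ^ 2 ∧
    ((IncidenceSystem.inclusionNumber IncidenceSystem.pappus
        (IncidenceSystem.ofConfiguration P L) : ℚ)
      = 2 / 3 * ((n ^ 2 + n + 1).choose 2 : ℚ) * (n.choose 3 : ℚ) ^ 2 ↔
      IncidenceSystem.IsFieldPlane (IncidenceSystem.ofConfiguration P L)) := by
  have hE := card_isPappusEmbedding (P := P) (L := L)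
  have hH := card_isHexagon (P := P) (L := L)
  have hL : Nat.card L = n ^ 2 + n + 1 := by
    have := Fintype.ofFinite L
    rw [Nat.card_eq_fintype_card, ProjectivePlane.card_lines P L, hn]
  rw [Nat.card_coe_set_eq] at hE hH
  rw [hL, hn, Nat.descFactorial_eq_factorial_mul_choose] at hH
  set E := {φ : Fin 3 × Fin 3 → P | IsPappusEmbedding L φ}
  set H := {φ : Fin 3 × Fin 3 → P | ∃ l m : L, IsHexagon l m φ}
  have hsub : E ⊆ H := fun φ hφ => hφ.isHexagon.1
  have hiff : E = H ↔ Pappian P L := by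
    rw [pappian_iff_forall_isHexagon]
    constructor
    · intro h l m φ hφ
      have : φ ∈ E := h ▸ ⟨l, m, hφ⟩
      exact this.isHexagon.2
    · intro h
      refine hsub.antisymm ?_
      rintro φ ⟨l, m, hφ⟩
      obtain ⟨k, hk⟩ := h l m φ hφ
      exact hφ.isPappusEmbedding hk
  have hcard : E = H ↔ E.ncard = H.ncard :=
    ⟨fun h => h ▸ rfl, fun h => Set.eq_of_subset_of_ncard_le hsub h.ge (Set.toFinite _)⟩
  have hle : E.ncard ≤ H.ncard := Set.ncard_le_ncard hsub (Set.toFinite _)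
  -- The ordered pairs contribute 2 · `choose 2` and the ordered triples (3!)² · (`choose 3`)², so
  -- the factor is 72 = 108 · 2/3.
  have hbound : (108 : ℚ) * (2 / 3 * ((n ^ 2 + n + 1).choose 2 : ℚ) * (n.choose 3 : ℚ) ^ 2) =
      H.ncard := by
    rw [hH, Nat.cast_choose_two]
    push_cast [Nat.factorial, Nat.add_sub_cancel]
    ring
  have hcount : (108 : ℚ) * inclusionNumber pappus (ofConfiguration P L) = E.ncard := by
    rw [hE]
    push_cast
    ring
  rw [isFieldPlane_iff_pappian, ← hiff, hcard, ← Nat.cast_inj (R := ℚ), ← hbound, ← hcount]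
  refine ⟨?_, by simp⟩
  rw [← Nat.cast_le (α := ℚ), ← hbound, ← hcount] at hle
  linarith
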